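/- **Setting.** Let $S,A$ be finite non-empty sets, $r:S\times A\to[0,1]$, and let $p_{s,a}$ be a probability distribution on $S$ for each $(s,a)\in S\times A$. For $\pi:S\to A$ put $P_\pi(s,s')=p_{s,\pi(s)}(s')$, and for $\gamma\in(0,1)$ let $v^\pi(s)=E^\pi_s\big[\sum_{t\ge0}\gamma^t r(X_t,A_t)\big]$ be the discounted value of $\pi$, where $X_0=s$, $A_t=\pi(X_t)$, $X_{t+1}\sim p_{X_t,A_t}$, and let $v^*(s)=\max_\pi v^\pi(s)$. The MDP is *uniformly ergodic* if for every $\pi:S\to A$ there are $m\ge1$, $q\in(0,1]$ and a probability distribution $\psi$ on $S$ with $P_\pi^m(s,\cdot)\ge q\,\psi(\cdot)$ for all $s\in S$. Its minorization time is $t_{\mathrm{minorize}}=\max_\pi\inf (m/q)$, the infimum being over all such $(m,q)$ for $P_\pi$. **Algorithm $\mathrm{PMBP}(\gamma,\zeta,n)$** ($\zeta>0$, $n\ge1$). Draw independent $Z(s,a)\sim\mathrm{Unif}(0,\zeta)$ and $S^{(1)}_{s,a},\dots,S^{(n)}_{s,a}\sim p_{s,a}$ for all $(s,a)$; put $R=r+Z$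 and $\hat p_{s,a}(s')=\frac1n\#\{i:S^{(i)}_{s,a}=s'\}$; solve $\hat v_0(s)=\max_a\{R(s,a)+\gamma\sum_{s'}\hat p_{s,a}(s')\hat v_0(s')\}$ and return any $\hat\pi_0$ with $\hat\pi_0(s)\in\arg\max_a\{R(s,a)+\gamma\sum_{s'}\hat p_{s,a}(s')\hat v_0(s')\}$ for all $s$. It uses $|S||A|n$ samples. For $\delta\in(0,1)$ put $$\beta_\delta(\eta)=2\log\Big(\frac{24|S||A|\log_2((1-\gamma)^{-1})}{(1-\gamma)^2\eta\delta}\Big),\qquad \eta^*_\delta=\frac{\zeta\delta(1-\gamma)}{9|S||A|^2}.$$ **Theorem.** There is a universal constant $C>0$ such that the following holds for every uniformly ergodic MDP as above, every $\gamma\in[1/2,1)$ with $t_{\mathrm{minorize}}\le(1-\gamma)^{-1}$, and every $\delta\in(0,1)$. 1. For all $\zeta>0$ and all integers $n\ge1$ with $n\ge 64\,\beta_\delta(\eta^*_\delta)(1-\gamma)^{-1}$, the policy $\hat\pi_0$ returned by $\mathrm{PMBP}(\gamma,\zeta,n)$ satisfies, with probability at least $1-\delta$, for all states, $$0\le v^*-v^{\hat\pi_0}\le\frac{2\zeta}{1-\gamma}+486\sqrt{\frac{\beta_\delta(\eta^*_\delta)\,t_{\mathrm{minorize}}}{(1-\gamma)^2n}}$$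 (where the square root is read as $0$ if $\beta_\delta(\eta^*_\delta)<0$, which can only happen for large $\zeta$). 2. Let $0<\epsilon\le\sqrt{t_{\mathrm{minorize}}/(1-\gamma)}$ and $\zeta=(1-\gamma)\epsilon/4$. For every integer $n\ge n_\epsilon:=4\cdot486^2\,\frac{t_{\mathrm{minorize}}\,\beta_\delta(\eta^*_\delta)}{(1-\gamma)^2\epsilon^2}$, the policy returned by $\mathrm{PMBP}(\gamma,\zeta,n)$ satisfies $0\le v^*-v^{\hat\pi_0}\le\epsilon$ in all states with probability at least $1-\delta$. With $\Lambda=\log\frac{|S||A|}{(1-\gamma)\,\delta\,\min(\epsilon,1)}$, the number of samples is $$|S||A|\lceil n_\epsilon\rceil\le C\,\frac{|S||A|\,t_{\mathrm{minorize}}}{(1-\gamma)^2\epsilon^2}\,\Lambda=\widetilde O\Big(\frac{|S||A|t_{\mathrm{minorize}}}{(1-\gamma)^2\epsilon^2}\Big),$$ and the minimum sample size required in part 1 is, for this $\zeta$, $$|S||A|\,\big\lceil 64\,\beta_\delta(\eta^*_\delta)(1-\gamma)^{-1}\big\rceil\le C\,\frac{|S||A|}{1-\gamma}\,\Lambda=\widetilde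 O\Big(\frac{|S||A|}{1-\gamma}\Big).$$ -/

import Mathlib

open MeasureTheory ProbabilityTheory
open scoped ENNReal

universe u v w

/-- A Markov decision process with state space `S` and action space `A`: the rewards
`r : S × A → [0,1]` and the transition laws `p_{s,a} ∈ 𝒫(S)`. -/
structure MDP (S : Type u) (A : Type v) where
  r : S → A → ℝ
  r_nonneg : ∀ s a, 0 ≤ r s a
  r_le_one : ∀ s a, r s a ≤ 1
  p : S → A → PMF S

namespace MDP

variable {S : Type u} {A : Type v}

section Transition

/-- The transition matrix `P_π(s,s') = p_{s,π(s)}(s')` of a stationary deterministic policy. -/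
noncomputable def transMatrix (M : MDP S A) (π : S → A) : Matrix S S ℝ :=
  fun s s' => (M.p s (π s) s').toReal

/-- `P^m(s,·) ≥ q ψ(·)` for all `s`, for some probability measure `ψ`, with `m ≥ 1` and
`0 < q ≤ 1`. -/
def Minorizes [Fintype S] [DecidableEq S] (P : Matrix S S ℝ) (m : ℕ) (q : ℝ) : Prop :=
  1 ≤ m ∧ 0 < q ∧ q ≤ 1 ∧ ∃ ψ : PMF S, ∀ s s', q * (ψ s').toReal ≤ (P ^ m) s s'

/-- Every stationary deterministic policy induces a chain satisfying a Doeblin condition. -/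
def UniformlyErgodic [Fintype S] [DecidableEq S] (M : MDP S A) : Prop :=
  ∀ π : S → A, ∃ (m : ℕ) (q : ℝ), Minorizes (M.transMatrix π) m q

/-- The minorization time of a transition matrix: the infimum of the admissible `m / q`. -/
noncomputable def kernelMinorizationTime [Fintype S] [DecidableEq S] (P : Matrix S S ℝ) : ℝ :=
  sInf {t : ℝ | ∃ (m : ℕ) (q : ℝ), Minorizes P m q ∧ t = m / q}

/-- The minorization time of the MDP: the maximum over the (finitely many) policies. -/
noncomputable def minorizationTime [Fintype S] [DecidableEq S] (M : MDP S A) : ℝ :=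
  ⨆ π : S → A, kernelMinorizationTime (M.transMatrix π)

end Transition

section Value

variable [Fintype S] [MeasurableSpace S] [DiscreteMeasurableSpace S]
  [Fintype A] [MeasurableSpace A] [DiscreteMeasurableSpace A]

/-- One step of the state-action chain under `π`: from `(s,a)` draw `s' ∼ p_{s,a}` and move to
`(s', π(s'))`. -/
noncomputable def stepKernel (M : MDP S A) (π : S → A) : Kernel (S × A) (S × A) :=
  Kernel.ofFunOfCountable fun x => ((M.p x.1 x.2).map fun s' => (s', π s')).toMeasure

instance (M : MDP S A) (π : S → A) : IsMarkovKernel (M.stepKernel π) :=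
  ⟨fun x => inferInstanceAs
    (IsProbabilityMeasure ((M.p x.1 x.2).map fun s' => (s', π s')).toMeasure)⟩

/-- The law of the next state-action pair given the history up to time `t`. -/
noncomputable def histKernel (M : MDP S A) (π : S → A) (t : ℕ) :
    Kernel (Finset.Iic t → S × A) (S × A) :=
  (M.stepKernel π).comap (fun h => h ⟨t, Finset.mem_Iic.2 le_rfl⟩) (measurable_pi_apply _)

instance (M : MDP S A) (π : S → A) (t : ℕ) : IsMarkovKernel (M.histKernel π t) := by
  unfold histKernel; infer_instance

/-- The law `Q_s^π` of the trajectory `(X_t, A_t)_{t ≥ 0}` under `π`, started at `X_0 = s`. -/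
noncomputable def pathLaw (M : MDP S A) (π : S → A) (s : S) : Measure (ℕ → S × A) :=
  Kernel.traj (X := fun _ => S × A) (M.histKernel π) 0 (fun _ => (s, π s))

/-- The discounted value `v^π(s) = E_s^π [∑_t γ^t r(X_t, A_t)]`. -/
noncomputable def value (M : MDP S A) (γ : ℝ) (π : S → A) (s : S) : ℝ :=
  ∫ h, ∑' t : ℕ, γ ^ t * M.r (h t).1 (h t).2 ∂(M.pathLaw π s)

/-- The optimal discounted value `v^*(s) = max_π v^π(s)`. -/
noncomputable def optValue (M : MDP S A) (γ : ℝ) (s : S) : ℝ :=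
  ⨆ π : S → A, M.value γ π s

end Value

end MDP

/-- The calls made to the generative model: `n` of them for each state-action pair. -/
abbrev SampleIndex (S : Type u) (A : Type v) (n : ℕ) : Type (max u v) := (S × A) × Fin n

/-- The total number of calls to the generative model. -/
def numSamples (S : Type u) (A : Type v) [Fintype S] [Fintype A] (n : ℕ) : ℕ :=
  Fintype.card (SampleIndex S A n)

/-- The empirical kernel `p̂_{s,a}(s') = (1/n) ∑_i 1{S_{s,a}^{(i)} = s'}`. -/
noncomputable def empiricalKernel {S : Type u} {A : Type v} {n : ℕ}
    (x : SampleIndex S A n → S) (s : S) (a : A) (s' : S) : ℝ :=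
  (1 / (n : ℝ)) * ∑ i : Fin n, Set.indicator {s'} (fun _ => (1 : ℝ)) (x ((s, a), i))

/-- The Bellman action value `R(s,a) + γ q_{s,a}[v]`. -/
noncomputable def actionValue {S : Type u} {A : Type v} [Fintype S] (γ : ℝ)
    (R : S → A → ℝ) (q : S → A → S → ℝ) (v : S → ℝ) (s : S) (a : A) : ℝ :=
  R s a + γ * ∑ s', q s a s' * v s'

/-- `π` is greedy with respect to a solution `v` of the Bellman equation
`v(s) = max_a {R(s,a) + γ q_{s,a}[v]}`. -/
def IsBellmanGreedy {S : Type u} {A : Type v} [Fintype S] (γ : ℝ)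
    (R : S → A → ℝ) (q : S → A → S → ℝ) (π : S → A) : Prop :=
  ∃ v : S → ℝ,
    (∀ s, IsGreatest (Set.range fun a => actionValue γ R q v s a) (v s)) ∧
    ∀ s a, actionValue γ R q v s a ≤ actionValue γ R q v s (π s)

namespace MDP

variable {S : Type u} {A : Type v}

/-- `π` may be returned by perturbed model-based planning `PMBP(γ, ζ, n)` when the reward
perturbation drawn is `z` and the samples drawn are `x` (ties in the argmax are broken freely). -/
def IsPMBPOutput [Fintype S] (M : MDP S A) (γ : ℝ) {n : ℕ} (z : S × A → ℝ)
    (x : SampleIndex S A n → S) (π : S → A) : Prop :=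
  IsBellmanGreedy γ (fun s a => M.r s a + z (s, a)) (empiricalKernel x) π

/-- The joint law of the randomness of `PMBP(γ, ζ, n)`: the perturbations `Z(s,a)` are uniform on
`[0,ζ]`, the samples `S_{s,a}^{(i)}` have law `p_{s,a}`, and all of them are independent. -/
noncomputable def pmbpLaw [Fintype S] [Fintype A] [MeasurableSpace S] (M : MDP S A) (ζ : ℝ)
    (n : ℕ) : Measure ((S × A → ℝ) × (SampleIndex S A n → S)) :=
  (Measure.pi fun _ : S × A => ProbabilityTheory.cond volume (Set.Icc 0 ζ)).prod
    (Measure.pi fun j : SampleIndex S A n => (M.p j.1.1 j.1.2).toMeasure)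

/-- With probability at least `1 - δ`, the policy `π̂` returned by `PMBP(γ, ζ, n)` satisfies
`0 ≤ v^* - v^{π̂} ≤ err` in every state; on every probability space carrying the randomness of the
algorithm, and for every way of breaking ties. (The event is exhibited as a measurable set, so that
no measurability of the tie-breaking is needed.) -/
def PMBPGuarantee [Fintype S] [MeasurableSpace S] [DiscreteMeasurableSpace S]
    [Fintype A] [MeasurableSpace A] [DiscreteMeasurableSpace A]
    (M : MDP S A) (γ ζ : ℝ) (n : ℕ) (δ err : ℝ) : Prop :=
  ∀ (Ω : Type w) [MeasurableSpace Ω] (μ : Measure Ω) [IsProbabilityMeasure μ]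
    (Z : Ω → S × A → ℝ) (X : Ω → SampleIndex S A n → S) (πhat : Ω → S → A),
    HasLaw (fun ω => (Z ω, X ω)) (M.pmbpLaw ζ n) μ →
    (∀ ω, M.IsPMBPOutput γ (Z ω) (X ω) (πhat ω)) →
    ∃ E : Set Ω, MeasurableSet E ∧ ENNReal.ofReal (1 - δ) ≤ μ E ∧
      ∀ ω ∈ E, ∀ s : S,
        0 ≤ M.optValue γ s - M.value γ (πhat ω) s ∧
        M.optValue γ s - M.value γ (πhat ω) s ≤ err

end MDP

/-- `β_δ(η) = 2 log (24 |S||A| log₂((1-γ)⁻¹) / ((1-γ)² η δ))`. -/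
noncomputable def betaParam (S : Type u) (A : Type v) [Fintype S] [Fintype A]
    (γ δ η : ℝ) : ℝ :=
  2 * Real.log (24 * Fintype.card S * Fintype.card A * Real.logb 2 (1 - γ)⁻¹ /
    ((1 - γ) ^ 2 * η * δ))

/-- `η_δ^* = ζ δ (1-γ) / (9 |S||A|²)`. -/
noncomputable def etaStar (S : Type u) (A : Type v) [Fintype S] [Fintype A]
    (γ ζ δ : ℝ) : ℝ :=
  ζ * δ * (1 - γ) / (9 * Fintype.card S * (Fintype.card A : ℝ) ^ 2)

/-- `β_δ(η_δ^*)`. -/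
noncomputable def betaStar (S : Type u) (A : Type v) [Fintype S] [Fintype A]
    (γ ζ δ : ℝ) : ℝ :=
  betaParam S A γ δ (etaStar S A γ ζ δ)

/-! Let `u` solve the empirical Bellman equation with perturbed rewards `R`, and let `v` be the true
value of a policy `π` for `R`. Then `D = u - v` satisfies `D = e + g + γ P_π D`. Here `e = γ (p̂ -
p) u`, taken at the actions of `π`, is the sampling error, and `g ≥ 0` is the Bellman gap of `π`,
zero for the greedy policy. Everything reduces to bounding `(1 - γ P_π)⁻¹ |e|`.

Bernstein's inequality gives `|e| ≲ √l σ_p(u) + l osc u` with `l = L / n`, `L` being half of the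
parameter β, and `σ(u) ≤ σ(v) + σ(D)`. Discounted one-step variances sum to much less than their
number times their maximum (`resolvent_wvar_le`). The Doeblin condition bounds the span of `v` by a
multiple of the minorization time `t` (`sub_le_kernelMinorizationTime`), so after centring `v` its
accumulated variance is `O(t / (1 - γ))`. By Cauchy-Schwarz the accumulated standard deviation is
`O(√t / (1 - γ))`, which is the claimed rate. The same variance inequality applied to `D` returns
only a fraction of the accumulated error itself, which is absorbed (`resolvent_abs_error_le`).
Applying this to the greedy and to the optimal policy gives `policyValue_sub_le_of_greedy`.

Bernstein's inequality needs a function independent of the samples averaged, while `u` depends on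
all of them. For each state `s`, the empirical model in which `s` is absorbing with value `c`
ignores the samples at `s`, and its solution is within `|u s - c|` of `u` in sup norm
(`abs_absorbed_sub_le`). A union bound over state-action pairs and a net of values `c` of mesh `ζ /
100` then suffices.

Of the perturbation only `0 ≤ Z ≤ ζ` is used: it moves values by at most `ζ / (1 - γ)`. When `ζ >
1/2` the bound exceeds the horizon and is trivial. -/

open scoped Matrix

/-! ### Mean, variance and oscillation under probability weights. -/

section WeightedVariance

variable {S : Type*} [Fintype S]

/-- The variance of `f` under the weights `p`. -/
noncomputable def wvar (p f : S → ℝ) : ℝ := p ⬝ᵥ (fun s => f s ^ 2) - (p ⬝ᵥ f) ^ 2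

/-- The standard deviation of `f` under the weights `p`. -/
noncomputable def wsd (p f : S → ℝ) : ℝ := √(wvar p f)

/-- The oscillation of a function on a finite set. -/
noncomputable def osc {S : Type*} (f : S → ℝ) : ℝ := ⨆ x : S × S, f x.1 - f x.2

theorem osc_le {S : Type*} [Nonempty S] {f : S → ℝ} {c : ℝ} (h : ∀ a b, f a - f b ≤ c) :
    osc f ≤ c :=
  ciSup_le fun x => h x.1 x.2

theorem sub_le_osc (f : S → ℝ) (a b : S) : f a - f b ≤ osc f :=
  le_ciSup (f := fun x : S × S => f x.1 - f x.2) (Set.finite_range _).bddAbove (a, b)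

theorem dotProduct_const_of_mem_stdSimplex {p : S → ℝ} (hp : p ∈ stdSimplex ℝ S) (c : ℝ) :
    p ⬝ᵥ (fun _ => c) = c := by
  simp [dotProduct, ← Finset.sum_mul, hp.2]

theorem dotProduct_le_of_mem_stdSimplex {p : S → ℝ} (hp : p ∈ stdSimplex ℝ S) {f : S → ℝ} {c : ℝ}
    (h : ∀ s, f s ≤ c) : p ⬝ᵥ f ≤ c := by
  rw [← dotProduct_const_of_mem_stdSimplex hp c]
  exact Finset.sum_le_sum fun s _ => mul_le_mul_of_nonneg_left (h s) (hp.1 s)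

theorem le_dotProduct_of_mem_stdSimplex {p : S → ℝ} (hp : p ∈ stdSimplex ℝ S) {f : S → ℝ} {c : ℝ}
    (h : ∀ s, c ≤ f s) : c ≤ p ⬝ᵥ f := by
  rw [← dotProduct_const_of_mem_stdSimplex hp c]
  exact Finset.sum_le_sum fun s _ => mul_le_mul_of_nonneg_left (h s) (hp.1 s)

theorem wvar_eq_dotProduct_sq {p : S → ℝ} (hp : p ∈ stdSimplex ℝ S) (f : S → ℝ) :
    wvar p f = p ⬝ᵥ (fun s => (f s - p ⬝ᵥ f) ^ 2) := by
  have h : ∀ m : ℝ, p ⬝ᵥ (fun s => (f s - m) ^ 2)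
      = p ⬝ᵥ (fun s => f s ^ 2) - 2 * m * (p ⬝ᵥ f) + m ^ 2 * ∑ s, p s := by
    intro m
    simp only [dotProduct, Finset.mul_sum, ← Finset.sum_sub_distrib, ← Finset.sum_add_distrib]
    exact Finset.sum_congr rfl fun s _ => by ring
  rw [h, hp.2, wvar]
  ring

theorem wvar_nonneg {p : S → ℝ} (hp : p ∈ stdSimplex ℝ S) (f : S → ℝ) : 0 ≤ wvar p f := by
  rw [wvar_eq_dotProduct_sq hp]
  exact Finset.sum_nonneg fun s _ => mul_nonneg (hp.1 s) (sq_nonneg _)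

theorem wvar_sub_const {p : S → ℝ} (hp : p ∈ stdSimplex ℝ S) (f : S → ℝ) (c : ℝ) :
    wvar p (fun s => f s - c) = wvar p f := by
  have h : p ⬝ᵥ (fun s => f s - c) = p ⬝ᵥ f - c := by
    have := dotProduct_const_of_mem_stdSimplex hp c
    rw [← this, ← dotProduct_sub, this]
    rfl
  rw [wvar_eq_dotProduct_sq hp, wvar_eq_dotProduct_sq hp, h]
  congr 1
  ext s
  ring

theorem wvar_le_sq {p : S → ℝ} (hp : p ∈ stdSimplex ℝ S) {f : S → ℝ} {c : ℝ}
    (h : ∀ s, |f s| ≤ c) : wvar p f ≤ c ^ 2 := by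
  have := dotProduct_le_of_mem_stdSimplex hp (f := fun s => f s ^ 2) (c := c ^ 2)
    fun s => sq_le_sq' (neg_le_of_abs_le (h s)) (le_of_abs_le (h s))
  unfold wvar
  nlinarith [sq_nonneg (p ⬝ᵥ f)]

theorem wsd_nonneg (p f : S → ℝ) : 0 ≤ wsd p f := Real.sqrt_nonneg _

theorem wsd_sq {p : S → ℝ} (hp : p ∈ stdSimplex ℝ S) (f : S → ℝ) : wsd p f ^ 2 = wvar p f :=
  Real.sq_sqrt (wvar_nonneg hp f)

theorem wsd_le {p : S → ℝ} (hp : p ∈ stdSimplex ℝ S) {f : S → ℝ} {c : ℝ} (hc : 0 ≤ c)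
    (h : ∀ s, |f s| ≤ c) : wsd p f ≤ c :=
  Real.sqrt_le_iff.2 ⟨hc, wvar_le_sq hp h⟩

/-- Realises the standard deviation as a Euclidean norm, so that its subadditivity is the triangle
inequality. -/
theorem wsd_eq_norm {p : S → ℝ} (hp : p ∈ stdSimplex ℝ S) (f : S → ℝ) :
    wsd p f = ‖WithLp.toLp 2 (fun s => √(p s) * (f s - p ⬝ᵥ f))‖ := by
  rw [EuclideanSpace.norm_eq, wsd, wvar_eq_dotProduct_sq hp]
  congr 1
  refine Finset.sum_congr rfl fun s _ => ?_
  rw [Real.norm_eq_abs, sq_abs, mul_pow, Real.sq_sqrt (hp.1 s)]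

theorem wsd_add_le {p : S → ℝ} (hp : p ∈ stdSimplex ℝ S) (f g : S → ℝ) :
    wsd p (f + g) ≤ wsd p f + wsd p g := by
  rw [wsd_eq_norm hp, wsd_eq_norm hp, wsd_eq_norm hp]
  refine le_trans (le_of_eq ?_) (norm_add_le _ _)
  rw [← WithLp.toLp_add]
  congr 2
  ext s
  simp only [dotProduct_add, Pi.add_apply]
  ring

end WeightedVariance

/-! ### The discounted resolvent: comparison principle and accumulated variances. -/

section Resolvent

variable {S : Type*} [Fintype S] [DecidableEq S] {P : Matrix S S ℝ} {γ : ℝ}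

theorem row_mem_stdSimplex (hP : P ∈ Matrix.rowStochastic ℝ S) (s : S) :
    P s ∈ stdSimplex ℝ S :=
  ⟨fun _ => Matrix.nonneg_of_mem_rowStochastic hP, Matrix.sum_row_of_mem_rowStochastic hP s⟩

/-- The maximum principle for `1 - γ P`. -/
theorem nonneg_of_smul_mulVec_le (hP : P ∈ Matrix.rowStochastic ℝ S) (h0 : 0 ≤ γ) (h1 : γ < 1)
    {y : S → ℝ} (h : γ • (P *ᵥ y) ≤ y) : 0 ≤ y := by
  intro s
  have : Nonempty S := ⟨s⟩
  obtain ⟨m, hm⟩ := Finite.exists_min y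
  -- At a minimiser `m`, `y m ≥ γ (P y) m ≥ γ y m`, and `γ < 1` forces `y m ≥ 0`.
  have h2 : y m ≤ P m ⬝ᵥ y := le_dotProduct_of_mem_stdSimplex (row_mem_stdSimplex hP m) hm
  have h3 : γ * (P m ⬝ᵥ y) ≤ y m := h m
  have h4 : 0 ≤ y m := by nlinarith
  exact h4.trans (hm s)

/-- The action of `(1 - γ P)⁻¹` on functions. -/
noncomputable def discResolvent (γ : ℝ) (P : Matrix S S ℝ) (f : S → ℝ) : S → ℝ := (1 - γ • P)⁻¹ *ᵥ f

theorem isUnit_one_sub_smul (hP : P ∈ Matrix.rowStochastic ℝ S) (h0 : 0 ≤ γ) (h1 : γ < 1) :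
    IsUnit (1 - γ • P) := by
  rw [← Matrix.mulVec_injective_iff_isUnit]
  intro x y hxy
  have key : ∀ z : S → ℝ, (1 - γ • P) *ᵥ z = 0 → 0 ≤ z := fun z hz => by
    refine nonneg_of_smul_mulVec_le hP h0 h1 ?_
    rw [Matrix.sub_mulVec, Matrix.one_mulVec, Matrix.smul_mulVec, sub_eq_zero] at hz
    exact hz.ge
  have h2 : (1 - γ • P) *ᵥ (x - y) = 0 := by
    rw [Matrix.mulVec_sub]; exact sub_eq_zero.2 hxy
  have h3 : (1 - γ • P) *ᵥ (y - x) = 0 := by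
    rw [Matrix.mulVec_sub]; exact sub_eq_zero.2 hxy.symm
  exact le_antisymm (sub_nonneg.1 (key _ h3)) (sub_nonneg.1 (key _ h2))

theorem resolvent_eq (hP : P ∈ Matrix.rowStochastic ℝ S) (h0 : 0 ≤ γ) (h1 : γ < 1) (f : S → ℝ) :
    discResolvent γ P f = f + γ • (P *ᵥ discResolvent γ P f) := by
  have h : (1 - γ • P) *ᵥ discResolvent γ P f = f := by
    rw [discResolvent, Matrix.mulVec_mulVec, Matrix.mul_nonsing_inv _
      ((Matrix.isUnit_iff_isUnit_det _).1 (isUnit_one_sub_smul hP h0 h1)), Matrix.one_mulVec]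
  rw [Matrix.sub_mulVec, Matrix.one_mulVec, Matrix.smul_mulVec] at h
  exact sub_eq_iff_eq_add.1 h

/-- Comparison principle: subsolutions lie below the solution. With `resolvent_le` it replaces
expansions of the resolvent in powers of `P`. -/
theorem le_resolvent (hP : P ∈ Matrix.rowStochastic ℝ S) (h0 : 0 ≤ γ) (h1 : γ < 1)
    {f y : S → ℝ} (h : y ≤ f + γ • (P *ᵥ y)) : y ≤ discResolvent γ P f := by
  rw [← sub_nonneg]
  refine nonneg_of_smul_mulVec_le hP h0 h1 ?_
  conv_rhs => rw [resolvent_eq hP h0 h1]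
  rw [Matrix.mulVec_sub, smul_sub]
  intro s
  have := h s
  simp only [Pi.add_apply, Pi.sub_apply] at this ⊢
  linarith

theorem resolvent_le (hP : P ∈ Matrix.rowStochastic ℝ S) (h0 : 0 ≤ γ) (h1 : γ < 1)
    {f y : S → ℝ} (h : f + γ • (P *ᵥ y) ≤ y) : discResolvent γ P f ≤ y := by
  rw [← sub_nonneg]
  refine nonneg_of_smul_mulVec_le hP h0 h1 ?_
  conv_rhs => rw [resolvent_eq hP h0 h1]
  rw [Matrix.mulVec_sub, smul_sub]
  intro s
  have := h s
  simp only [Pi.add_apply, Pi.sub_apply] at this ⊢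
  linarith

theorem eq_resolvent (hP : P ∈ Matrix.rowStochastic ℝ S) (h0 : 0 ≤ γ) (h1 : γ < 1)
    {f y : S → ℝ} (h : y = f + γ • (P *ᵥ y)) : y = discResolvent γ P f :=
  le_antisymm (le_resolvent hP h0 h1 h.le) (resolvent_le hP h0 h1 h.ge)

theorem resolvent_mono (hP : P ∈ Matrix.rowStochastic ℝ S) (h0 : 0 ≤ γ) (h1 : γ < 1)
    {f g : S → ℝ} (h : f ≤ g) : discResolvent γ P f ≤ discResolvent γ P g := by
  refine le_resolvent hP h0 h1 ?_
  conv_lhs => rw [resolvent_eq hP h0 h1]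
  exact add_le_add_left h _

theorem resolvent_add (f g : S → ℝ) :
    discResolvent γ P (f + g) = discResolvent γ P f + discResolvent γ P g := Matrix.mulVec_add _ _ _

theorem resolvent_smul (c : ℝ) (f : S → ℝ) :
    discResolvent γ P (c • f) = c • discResolvent γ P f := Matrix.mulVec_smul _ _ _

theorem resolvent_const (hP : P ∈ Matrix.rowStochastic ℝ S) (h0 : 0 ≤ γ) (h1 : γ < 1) (c : ℝ) :
    discResolvent γ P (fun _ => c) = fun _ => (1 - γ)⁻¹ * c := by
  refine (eq_resolvent hP h0 h1 ?_).symm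
  ext s
  have h : (P *ᵥ fun _ => (1 - γ)⁻¹ * c) s = (1 - γ)⁻¹ * c :=
    dotProduct_const_of_mem_stdSimplex (row_mem_stdSimplex hP s) _
  have : (1 - γ) ≠ 0 := by linarith
  simp only [Pi.add_apply, Pi.smul_apply, h, smul_eq_mul]
  field_simp
  ring

theorem resolvent_nonneg (hP : P ∈ Matrix.rowStochastic ℝ S) (h0 : 0 ≤ γ) (h1 : γ < 1)
    {f : S → ℝ} (h : 0 ≤ f) : 0 ≤ discResolvent γ P f := by
  refine le_resolvent hP h0 h1 ?_
  simpa using h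

theorem abs_resolvent_le (hP : P ∈ Matrix.rowStochastic ℝ S) (h0 : 0 ≤ γ) (h1 : γ < 1)
    (f : S → ℝ) (s : S) : |discResolvent γ P f s| ≤ discResolvent γ P (fun s => |f s|) s := by
  rw [abs_le]
  constructor
  · have h := resolvent_mono hP h0 h1 (f := (-1 : ℝ) • f) (g := fun s => |f s|)
      (fun s => by simpa using neg_le_abs (f s)) s
    rw [resolvent_smul] at h
    simp only [Pi.smul_apply, smul_eq_mul] at h
    linarith
  · exact resolvent_mono hP h0 h1 (fun s => le_abs_self (f s)) s

/-- Jensen's inequality for the averaging operator `(1 - γ) (1 - γ P)⁻¹`, obtained from the tangent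
line `2 a f ≤ f² + a²` at the mean `a`. -/
theorem sq_resolvent_le (hP : P ∈ Matrix.rowStochastic ℝ S) (h0 : 0 ≤ γ) (h1 : γ < 1)
    (f : S → ℝ) (s : S) :
    discResolvent γ P f s ^ 2 ≤ (1 - γ)⁻¹ * discResolvent γ P (fun s => f s ^ 2) s := by
  have hH : 0 < 1 - γ := by linarith
  set y := discResolvent γ P f s with hy
  set a : ℝ := (1 - γ) * y
  have h := resolvent_mono hP h0 h1 (f := (2 * a) • f)
    (g := (fun s => f s ^ 2) + fun _ => a ^ 2)
    (fun s => by
      simp only [Pi.smul_apply, Pi.add_apply, smul_eq_mul]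
      nlinarith [sq_nonneg (f s - a)]) s
  rw [resolvent_smul, resolvent_add, resolvent_const hP h0 h1] at h
  simp only [Pi.smul_apply, Pi.add_apply, smul_eq_mul, ← hy] at h
  have h2 : (1 - γ)⁻¹ * a ^ 2 = (1 - γ) * y ^ 2 := by
    simp only [a]; field_simp
  rw [h2] at h
  have h3 : (1 - γ) * y ^ 2 ≤ discResolvent γ P (fun s => f s ^ 2) s := by
    simp only [a] at h
    nlinarith
  rw [inv_mul_eq_div, le_div_iff₀ hH]
  linarith

/-- The discounted sum of one-step variances of `D = h + γ P D`. -/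
theorem resolvent_wvar_le (hP : P ∈ Matrix.rowStochastic ℝ S) (h0 : 0 ≤ γ) (h1 : γ < 1)
    {D h : S → ℝ} (hD : D = h + γ • (P *ᵥ D)) (s : S) :
    γ * discResolvent γ P (fun s => wvar (P s) D) s ≤
      2 * discResolvent γ P (fun s => D s * h s) s := by
  -- `D²` is a subsolution: `P D² = wvar + (P D)²`, and `γ (P D)² ≥ (γ P D)² = (D - h)²`. The result
  -- follows by dropping `D² ≥ 0`.
  have key : (fun s => D s ^ 2) ≤
      discResolvent γ P ((2 : ℝ) • (fun s => D s * h s) + (-γ) • fun s => wvar (P s) D) := by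
    refine le_resolvent hP h0 h1 fun s => ?_
    have h2 : D s = h s + γ * (P s ⬝ᵥ D) := congrFun hD s
    have h3 : (P *ᵥ fun s => D s ^ 2) s = P s ⬝ᵥ fun s => D s ^ 2 := rfl
    simp only [Pi.add_apply, Pi.smul_apply, smul_eq_mul, h3, wvar]
    have h4 : γ * (P s ⬝ᵥ D) = D s - h s := by linarith
    have h5 : γ * (P s ⬝ᵥ D) ^ 2 ≥ (D s - h s) ^ 2 := by
      rw [← h4]
      nlinarith [sq_nonneg (P s ⬝ᵥ D), mul_nonneg h0 (sub_nonneg.2 h1.le)]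
    nlinarith [sq_nonneg (h s)]
  have := key s
  rw [resolvent_add, resolvent_smul, resolvent_smul] at this
  simp only [Pi.add_apply, Pi.smul_apply, smul_eq_mul] at this
  nlinarith [sq_nonneg (D s)]

theorem resolvent_sq_wsd (hP : P ∈ Matrix.rowStochastic ℝ S) (D : S → ℝ) :
    (fun s => wsd (P s) D ^ 2) = fun s => wvar (P s) D :=
  funext fun s => wsd_sq (row_mem_stdSimplex hP s) D

theorem resolvent_wsd_le_sqrt (hP : P ∈ Matrix.rowStochastic ℝ S) (h0 : 0 ≤ γ) (h1 : γ < 1)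
    (D : S → ℝ) (s : S) {V : ℝ} (hV : discResolvent γ P (fun s => wvar (P s) D) s ≤ V) :
    discResolvent γ P (fun s => wsd (P s) D) s ≤ √((1 - γ)⁻¹ * V) := by
  have hH : 0 < (1 - γ)⁻¹ := inv_pos.2 (by linarith)
  refine Real.le_sqrt_of_sq_le ((sq_resolvent_le hP h0 h1 _ s).trans ?_)
  rw [resolvent_sq_wsd hP]
  exact mul_le_mul_of_nonneg_left hV hH.le

end Resolvent

/-! ### Span and variance of value functions; accumulation of one-step errors. -/

section ValueBounds

variable {S : Type*} [Fintype S] [DecidableEq S] {P : Matrix S S ℝ} {γ : ℝ}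

theorem discResolvent_le_mul (hP : P ∈ Matrix.rowStochastic ℝ S) (h0 : 0 ≤ γ) (h1 : γ < 1)
    {f : S → ℝ} {c : ℝ} (h : ∀ s, f s ≤ c) (s : S) :
    discResolvent γ P f s ≤ (1 - γ)⁻¹ * c := by
  have := resolvent_mono hP h0 h1 (f := f) (g := fun _ => c) h s
  rwa [resolvent_const hP h0 h1] at this

/-- Unrolling `v = r + γ P v` over `m` steps. -/
theorem exists_unroll (hP : P ∈ Matrix.rowStochastic ℝ S) (h0 : 0 ≤ γ) (h1 : γ < 1)
    {v r : S → ℝ} {ρ : ℝ} (hv : v = r + γ • (P *ᵥ v)) (hr0 : ∀ s, 0 ≤ r s) (hr1 : ∀ s, r s ≤ ρ)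
    (m : ℕ) :
    ∃ g : S → ℝ, (∀ s, 0 ≤ g s) ∧ (∀ s, g s ≤ m * ρ) ∧ v = g + γ ^ m • (P ^ m *ᵥ v) := by
  induction m with
  | zero => exact ⟨0, by simp, by simp, by simp⟩
  | succ m ih =>
    obtain ⟨g, hg0, hg1, hg⟩ := ih
    have hPm := pow_mem hP m
    have hγ : 0 ≤ γ ^ m := pow_nonneg h0 m
    have hγ1 : γ ^ m ≤ 1 := pow_le_one₀ h0 h1.le
    have e1 : ∀ s, (P ^ m *ᵥ r) s = (P ^ m) s ⬝ᵥ r := fun _ => rfl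
    have l0 : ∀ s, 0 ≤ (P ^ m *ᵥ r) s := fun s =>
      le_dotProduct_of_mem_stdSimplex (row_mem_stdSimplex hPm s) hr0
    have l1 : ∀ s, (P ^ m *ᵥ r) s ≤ ρ := fun s =>
      dotProduct_le_of_mem_stdSimplex (row_mem_stdSimplex hPm s) hr1
    refine ⟨g + γ ^ m • (P ^ m *ᵥ r), fun s => ?_, fun s => ?_, ?_⟩
    · exact add_nonneg (hg0 s) (mul_nonneg hγ (l0 s))
    · simp only [Pi.add_apply, Pi.smul_apply, smul_eq_mul, Nat.cast_add, Nat.cast_one]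
      have : γ ^ m * (P ^ m *ᵥ r) s ≤ 1 * ρ :=
        mul_le_mul hγ1 (l1 s) (l0 s) zero_le_one
      linarith [hg1 s]
    · conv_lhs => rw [hg]
      conv_lhs => rw [hv]
      rw [Matrix.mulVec_add, smul_add, Matrix.mulVec_smul, smul_smul, ← pow_succ,
        Matrix.mulVec_mulVec, ← pow_succ, add_assoc]

/-- A Doeblin condition bounds the span of the discounted value by the rewards collected over the
minorization time. -/
theorem sub_le_of_minorizes (hP : P ∈ Matrix.rowStochastic ℝ S) (h0 : 0 ≤ γ) (h1 : γ < 1)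
    {v r : S → ℝ} {ρ : ℝ} (hv : v = r + γ • (P *ᵥ v)) (hr0 : ∀ s, 0 ≤ r s) (hr1 : ∀ s, r s ≤ ρ)
    {m : ℕ} {q : ℝ} (hq : MDP.Minorizes P m q) (a b : S) : v a - v b ≤ ρ * (m / q) := by
  obtain ⟨-, hq0, hq1, ψ, hψ⟩ := hq
  obtain ⟨g, hg0, hg1, hg⟩ := exists_unroll hP h0 h1 hv hr0 hr1 m
  have : Nonempty S := ⟨a⟩
  obtain ⟨x, hx⟩ := Finite.exists_max v
  obtain ⟨y, hy⟩ := Finite.exists_min v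
  have hPm := pow_mem hP m
  have hψ1 : ∑ s, (ψ s).toReal = 1 := by
    rw [← ENNReal.toReal_sum fun s _ => ψ.apply_ne_top s, ← tsum_fintype (L := .unconditional _),
      ψ.tsum_coe]
    simp
  have hsum : ∀ s, ∑ s', ((P ^ m) s s' - q * (ψ s').toReal) = 1 - q := fun s => by
    rw [Finset.sum_sub_distrib, ← Finset.mul_sum, hψ1, Matrix.sum_row_of_mem_rowStochastic hPm,
      mul_one]
  have hsplit : ∀ s, (P ^ m *ᵥ v) s =
      ∑ s', ((P ^ m) s s' - q * (ψ s').toReal) * v s' + q * ∑ s', (ψ s').toReal * v s' := fun s => by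
    rw [Finset.mul_sum, ← Finset.sum_add_distrib]
    exact Finset.sum_congr rfl fun s' _ => by ring
  -- Split `P ^ m` into `q ψ` and a nonnegative remainder of mass `1 - q`. The `ψ` part is common to
  -- all rows and cancels between the extremal states `x` and `y`, so the span contracts by `1 - q`.
  have up : (P ^ m *ᵥ v) x ≤ (1 - q) * v x + q * ∑ s', (ψ s').toReal * v s' := by
    rw [hsplit, ← hsum x, Finset.sum_mul]
    exact add_le_add_left (Finset.sum_le_sum fun s' _ =>
      mul_le_mul_of_nonneg_left (hx s') (sub_nonneg.2 (hψ x s'))) _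
  have low : (1 - q) * v y + q * ∑ s', (ψ s').toReal * v s' ≤ (P ^ m *ᵥ v) y := by
    rw [hsplit, ← hsum y, Finset.sum_mul]
    exact add_le_add_left (Finset.sum_le_sum fun s' _ =>
      mul_le_mul_of_nonneg_left (hy s') (sub_nonneg.2 (hψ y s'))) _
  have ex : v x = g x + γ ^ m * (P ^ m *ᵥ v) x := congrFun hg x
  have ey : v y = g y + γ ^ m * (P ^ m *ᵥ v) y := congrFun hg y
  have hγ : 0 ≤ γ ^ m := pow_nonneg h0 m
  have hγ1 : γ ^ m ≤ 1 := pow_le_one₀ h0 h1.le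
  have hD : 0 ≤ (1 - q) * (v x - v y) := mul_nonneg (by linarith) (by linarith [hx y])
  have k1 : γ ^ m * ((P ^ m *ᵥ v) x - (P ^ m *ᵥ v) y) ≤ (1 - q) * (v x - v y) :=
    calc γ ^ m * ((P ^ m *ᵥ v) x - (P ^ m *ᵥ v) y) ≤ γ ^ m * ((1 - q) * (v x - v y)) :=
          mul_le_mul_of_nonneg_left (by linarith) hγ
      _ ≤ _ := mul_le_of_le_one_left hD hγ1
  have k2 : q * (v x - v y) ≤ m * ρ := by nlinarith [hg1 x, hg0 y]
  have k3 : v x - v y ≤ ρ * (m / q) := by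
    rw [← mul_div_assoc, le_div_iff₀ hq0]; linarith
  linarith [hx a, hy b]

theorem sub_le_kernelMinorizationTime (hP : P ∈ Matrix.rowStochastic ℝ S) (h0 : 0 ≤ γ) (h1 : γ < 1)
    {v r : S → ℝ} {ρ : ℝ} (hρ : 0 < ρ) (hv : v = r + γ • (P *ᵥ v)) (hr0 : ∀ s, 0 ≤ r s)
    (hr1 : ∀ s, r s ≤ ρ) (hmin : ∃ m q, MDP.Minorizes P m q) (a b : S) :
    v a - v b ≤ ρ * MDP.kernelMinorizationTime P := by
  rw [← div_le_iff₀' hρ]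
  obtain ⟨m, q, h⟩ := hmin
  refine le_csInf ⟨_, m, q, h, rfl⟩ ?_
  rintro _ ⟨m, q, h, rfl⟩
  rw [div_le_iff₀' hρ]
  exact sub_le_of_minorizes hP h0 h1 hv hr0 hr1 h a b

/-- The discounted sum of one-step variances of a value function of span at most `T`. -/
theorem resolvent_wvar_value_le (hP : P ∈ Matrix.rowStochastic ℝ S) (h0 : 1 / 2 ≤ γ) (h1 : γ < 1)
    {v r : S → ℝ} {ρ T : ℝ} (hv : v = r + γ • (P *ᵥ v)) (hr0 : ∀ s, 0 ≤ r s)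
    (hr1 : ∀ s, r s ≤ ρ) (hT : ∀ a b, v a - v b ≤ T) (s : S) :
    discResolvent γ P (fun s => wvar (P s) v) s ≤ 4 * T * ρ * (1 - γ)⁻¹ := by
  have hγ : 0 ≤ γ := by linarith
  have hH : 0 < (1 - γ) := by linarith
  have hv2 := eq_resolvent hP hγ h1 hv
  set c := v s with hc
  have c0 : 0 ≤ c := by rw [hc, hv2]; exact resolvent_nonneg hP hγ h1 hr0 s
  have c1 : (1 - γ) * c ≤ ρ := by
    have : c ≤ (1 - γ)⁻¹ * ρ := by rw [hc, hv2]; exact discResolvent_le_mul hP hγ h1 hr1 s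
    rwa [inv_mul_eq_div, le_div_iff₀ hH, mul_comm] at this
  have hT0 : 0 ≤ T := by simpa using hT s s
  -- Centring at `c = v s` leaves variances unchanged but bounds the function by the span `T`
  -- instead of the horizon; the source becomes `r - (1 - γ) c`, still at most `ρ` in absolute
  -- value.
  have hw : (fun s => v s - c) = (fun s => r s - (1 - γ) * c) + γ • (P *ᵥ fun s => v s - c) := by
    ext x
    have e1 : v x = r x + γ * (P *ᵥ v) x := congrFun hv x
    have e2 : (P *ᵥ fun s => v s - c) x = (P *ᵥ v) x - c := by
      have : (fun s => v s - c) = v - fun _ => c := rfl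
      rw [this, Matrix.mulVec_sub]
      simp only [Pi.sub_apply]
      congr 1
      exact dotProduct_const_of_mem_stdSimplex (row_mem_stdSimplex hP x) c
    simp only [Pi.add_apply, Pi.smul_apply, smul_eq_mul, e2]
    linarith
  have key := resolvent_wvar_le hP hγ h1 hw s
  have e3 : (fun x => wvar (P x) fun s => v s - c) = fun x => wvar (P x) v :=
    funext fun x => wvar_sub_const (row_mem_stdSimplex hP x) v c
  rw [e3] at key
  have b1 : ∀ x, (v x - c) * (r x - (1 - γ) * c) ≤ T * ρ := fun x => by
    have t1 : |v x - c| ≤ T := abs_le.2 ⟨by linarith [hT s x], hT x s⟩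
    have t2 : |r x - (1 - γ) * c| ≤ ρ :=
      abs_le.2 ⟨by linarith [hr0 x], by nlinarith [hr1 x]⟩
    calc _ ≤ |(v x - c) * (r x - (1 - γ) * c)| := le_abs_self _
      _ = |v x - c| * |r x - (1 - γ) * c| := abs_mul _ _
      _ ≤ T * ρ := mul_le_mul t1 t2 (abs_nonneg _) hT0
  have b2 := discResolvent_le_mul hP hγ h1 b1 s
  have b3 : 0 ≤ discResolvent γ P (fun s => wvar (P s) v) s :=
    resolvent_nonneg hP hγ h1 (fun x => wvar_nonneg (row_mem_stdSimplex hP x) v) s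
  nlinarith

/-- Bernstein-type one-step errors `e` accumulate to a multiple of the statistical rate, up to a
fraction of any a priori bound `M` on the accumulated error. -/
theorem resolvent_abs_error_le (hP : P ∈ Matrix.rowStochastic ℝ S) (h0 : 1 / 2 ≤ γ) (h1 : γ < 1)
    {v r u e g : S → ℝ} {t l c M : ℝ} (hv : v = r + γ • (P *ᵥ v)) (hr0 : ∀ s, 0 ≤ r s)
    (hr1 : ∀ s, r s ≤ 3 / 2) (ht0 : 0 ≤ t) (ht : t ≤ (1 - γ)⁻¹)
    (hT : ∀ a b, v a - v b ≤ 3 / 2 * t) (hl0 : 0 ≤ l) (hl : 128 * l * (1 - γ)⁻¹ ≤ 1)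
    (hD : u - v = e + g + γ • (P *ᵥ (u - v))) (hg : ∀ s, 0 ≤ g s)
    (he : ∀ s, |e s| ≤ 2 * √l * wsd (P s) u + l * osc u + c)
    (hM : ∀ s, discResolvent γ P (fun s => |e s|) s ≤ M) (hDM : ∀ s, u s - v s ≤ M)
    (hosc : osc u ≤ 3 / 2 * t + 2 * M) (s : S) :
    discResolvent γ P (fun s => |e s|) s ≤
      7 * ((1 - γ)⁻¹ * √(l * t)) + 16 / 25 * M + (1 - γ)⁻¹ * c := by
  have hγ : 0 ≤ γ := by linarith
  have hH : 0 < (1 - γ)⁻¹ := inv_pos.2 (by linarith)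
  set H := (1 - γ)⁻¹ with hHdef
  have hM0 : 0 ≤ M := (resolvent_nonneg hP hγ h1 (fun s => abs_nonneg (e s)) s).trans (hM s)
  have hDeq := eq_resolvent hP hγ h1 hD
  have hDlow : ∀ x, -M ≤ u x - v x := fun x => by
    have a1 : (u - v) x = discResolvent γ P e x + discResolvent γ P g x := by
      rw [hDeq, resolvent_add]; rfl
    have a2 := abs_le.1 (abs_resolvent_le hP hγ h1 e x)
    have a3 : 0 ≤ discResolvent γ P g x := resolvent_nonneg hP hγ h1 hg x
    simp only [Pi.sub_apply] at a1
    linarith [hM x, a2.1]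
  have hDabs : ∀ x, |(u - v) x| ≤ M := fun x => abs_le.2 ⟨hDlow x, hDM x⟩
  -- The resolvent of `g` is that of `e + g`, namely `D ≤ M`, minus that of `e`, which is at least
  -- `-M`.
  have hKg : ∀ x, discResolvent γ P g x ≤ 2 * M := fun x => by
    have a1 : (u - v) x = discResolvent γ P e x + discResolvent γ P g x := by
      rw [hDeq, resolvent_add]; rfl
    have a2 := abs_le.1 (abs_resolvent_le hP hγ h1 e x)
    linarith [hM x, a2.1, (abs_le.1 (hDabs x)).2]
  -- The source `e + g` accumulates to at most `M + 2 M` and `|D| ≤ M`, giving `2 * 3 M²`; dividing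
  -- by `γ ≥ 1/2` doubles it.
  have hVD : ∀ x, discResolvent γ P (fun s => wvar (P s) (u - v)) x ≤ 12 * M ^ 2 := fun x => by
    have key := resolvent_wvar_le hP hγ h1 hD x
    have a1 : discResolvent γ P (fun s => (u - v) s * (e + g) s) x ≤ 3 * M ^ 2 := by
      have := resolvent_mono hP hγ h1 (f := fun s => (u - v) s * (e + g) s)
        (g := M • ((fun s => |e s|) + g)) (fun y => by
          simp only [Pi.smul_apply, Pi.add_apply, smul_eq_mul]
          calc (u - v) y * (e y + g y) ≤ |(u - v) y * (e y + g y)| := le_abs_self _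
            _ = |(u - v) y| * |e y + g y| := abs_mul _ _
            _ ≤ M * (|e y| + g y) := mul_le_mul (hDabs y)
                ((abs_add_le _ _).trans_eq (by rw [abs_of_nonneg (hg y)])) (abs_nonneg _) hM0) x
      rw [resolvent_smul, resolvent_add] at this
      simp only [Pi.smul_apply, Pi.add_apply, smul_eq_mul] at this
      refine this.trans ?_
      nlinarith [hM x, hKg x]
    have a2 : 0 ≤ discResolvent γ P (fun s => wvar (P s) (u - v)) x :=
      resolvent_nonneg hP hγ h1 (fun y => wvar_nonneg (row_mem_stdSimplex hP y) _) x
    nlinarith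
  have hVv := resolvent_wvar_value_le hP h0 h1 hv hr0 hr1 hT s
  have s1 : discResolvent γ P (fun s => wsd (P s) v) s ≤ √(H * (9 * t * H)) :=
    resolvent_wsd_le_sqrt hP hγ h1 v s (hVv.trans_eq (by ring))
  have s2 : discResolvent γ P (fun s => wsd (P s) (u - v)) s ≤ √(H * (12 * M ^ 2)) :=
    resolvent_wsd_le_sqrt hP hγ h1 (u - v) s (hVD s)
  have hmain : discResolvent γ P (fun s => |e s|) s ≤
      2 * √l * (√(H * (9 * t * H)) + √(H * (12 * M ^ 2))) + H * (l * osc u + c) := by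
    have := resolvent_mono hP hγ h1 (f := fun s => |e s|)
      (g := (2 * √l) • ((fun s => wsd (P s) v) + fun s => wsd (P s) (u - v)) +
        fun _ => l * osc u + c) (fun y => by
          simp only [Pi.smul_apply, Pi.add_apply, smul_eq_mul]
          have b1 := wsd_add_le (row_mem_stdSimplex hP y) v (u - v)
          rw [add_sub_cancel] at b1
          have b2 : 2 * √l * wsd (P y) u ≤ 2 * √l * (wsd (P y) v + wsd (P y) (u - v)) :=
            mul_le_mul_of_nonneg_left b1 (by positivity)
          linarith [he y]) s
    rw [resolvent_add, resolvent_smul, resolvent_add, resolvent_const hP hγ h1] at this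
    simp only [Pi.smul_apply, Pi.add_apply, smul_eq_mul] at this
    refine this.trans (add_le_add_left ?_ _)
    exact mul_le_mul_of_nonneg_left (add_le_add s1 s2) (by positivity)
  have q1 : √l * √(H * (9 * t * H)) = 3 * (H * √(l * t)) := by
    rw [← Real.sqrt_mul hl0, show l * (H * (9 * t * H)) = (l * t) * (3 * H) ^ 2 by ring,
      Real.sqrt_mul (by positivity), Real.sqrt_sq (by positivity)]
    ring
  -- From `l H ≤ 1/128` and `12/128 ≤ (31/100)²`.
  have q2 : √l * √(H * (12 * M ^ 2)) ≤ 31 / 100 * M := by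
    rw [← Real.sqrt_mul hl0]
    refine Real.sqrt_le_iff.2 ⟨by positivity, ?_⟩
    nlinarith [mul_le_mul_of_nonneg_right hl (sq_nonneg M)]
  have q3 : l * t ≤ 1 / 8 * √(l * t) := by
    have a1 : l * t ≤ (1 / 8) ^ 2 := by nlinarith [mul_le_mul_of_nonneg_left ht hl0]
    have a2 : √(l * t) ≤ 1 / 8 := Real.sqrt_le_iff.2 ⟨by norm_num, a1⟩
    have a3 := Real.mul_self_sqrt (mul_nonneg hl0 ht0)
    nlinarith [Real.sqrt_nonneg (l * t)]
  have q4 : H * (l * osc u) ≤ 3 / 16 * (H * √(l * t)) + 1 / 64 * M := by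
    have a1 : H * (l * osc u) ≤ H * (l * (3 / 2 * t + 2 * M)) := by gcongr
    have a2 : H * (l * t) ≤ H * (1 / 8 * √(l * t)) := by gcongr
    have a3 : (128 * l * H) * M ≤ 1 * M := by gcongr
    nlinarith
  have q5 : 0 ≤ H * √(l * t) := by positivity
  -- The constants add up as `2 * 3 + 3/16 ≤ 7` and `2 * 31/100 + 1/64 ≤ 16/25`; a coefficient of
  -- `M` below 1 is what makes the bound self-improving.
  nlinarith

end ValueBounds

/-! ### Bellman equations and the suboptimality of greedy policies. -/

section Bellman

variable {S : Type u} {A : Type v} [Fintype S] {γ : ℝ}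

/-- `v` solves the Bellman equation with rewards `R` and transition weights `q`. -/
def IsBellmanSolution (γ : ℝ) (R : S → A → ℝ) (q : S → A → S → ℝ) (v : S → ℝ) : Prop :=
  ∀ s, IsGreatest (Set.range fun a => actionValue γ R q v s a) (v s)

theorem actionValue_sub_le {R R' : S → A → ℝ} {q : S → A → S → ℝ}
    (hq : ∀ s a, q s a ∈ stdSimplex ℝ S) (h0 : 0 ≤ γ) {f g : S → ℝ} {c d : ℝ}
    (hR : ∀ s a, R s a - R' s a ≤ d) (h : ∀ s, f s - g s ≤ c) (s : S) (a : A) :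
    actionValue γ R q f s a - actionValue γ R' q g s a ≤ d + γ * c := by
  have h2 : q s a ⬝ᵥ (f - g) ≤ c := dotProduct_le_of_mem_stdSimplex (hq s a) h
  rw [dotProduct_sub] at h2
  have h3 := mul_le_mul_of_nonneg_left h2 h0
  simp only [dotProduct, mul_sub] at h3
  simp only [actionValue]
  linarith [hR s a]

/-- At a maximiser of `f - g`, comparing both equations at the action optimal for `f` gives `max (f
- g) ≤ d + γ max (f - g)`. In particular solutions are unique and Lipschitz in the rewards. -/
theorem IsBellmanSolution.sub_le {R R' : S → A → ℝ} {q : S → A → S → ℝ}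
    (hq : ∀ s a, q s a ∈ stdSimplex ℝ S) (h0 : 0 ≤ γ) (h1 : γ < 1) {f g : S → ℝ} {d : ℝ}
    (hf : IsBellmanSolution γ R q f) (hg : IsBellmanSolution γ R' q g)
    (hR : ∀ s a, R s a - R' s a ≤ d) (s : S) : f s - g s ≤ (1 - γ)⁻¹ * d := by
  have : Nonempty S := ⟨s⟩
  obtain ⟨m, hm⟩ := Finite.exists_max (f - g)
  obtain ⟨a, ha⟩ := (hf m).1
  have h2 := actionValue_sub_le hq h0 hR hm m a
  have h3 := (hg m).2 ⟨a, rfl⟩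
  simp only at ha h3
  simp only [Pi.sub_apply] at h2 hm
  have h4 : f m - g m ≤ (1 - γ)⁻¹ * d := by
    rw [inv_mul_eq_div, le_div_iff₀ (by linarith)]
    linarith
  exact (hm s).trans h4

theorem IsBellmanSolution.abs_sub_le {R R' : S → A → ℝ} {q : S → A → S → ℝ}
    (hq : ∀ s a, q s a ∈ stdSimplex ℝ S) (h0 : 0 ≤ γ) (h1 : γ < 1) {f g : S → ℝ} {d : ℝ}
    (hf : IsBellmanSolution γ R q f) (hg : IsBellmanSolution γ R' q g)
    (hR : ∀ s a, |R s a - R' s a| ≤ d) (s : S) : |f s - g s| ≤ (1 - γ)⁻¹ * d := by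
  rw [abs_le]
  have h2 := hf.sub_le hq h0 h1 hg (fun s a => (abs_le.1 (hR s a)).2) s
  have h3 := hg.sub_le hq h0 h1 hf (d := d)
    (fun s a => by linarith [(abs_le.1 (hR s a)).1]) s
  exact ⟨by linarith, h2⟩

theorem exists_isBellmanSolution [Finite A] [Nonempty A] (R : S → A → ℝ) {q : S → A → S → ℝ}
    (hq : ∀ s a, q s a ∈ stdSimplex ℝ S) (h0 : 0 ≤ γ) (h1 : γ < 1) :
    ∃ v, IsBellmanSolution γ R q v := by
  let T : (S → ℝ) → S → ℝ := fun f s => ⨆ a, actionValue γ R q f s a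
  have hle : ∀ f s a, actionValue γ R q f s a ≤ T f s := fun f s a =>
    le_ciSup (f := fun a => actionValue γ R q f s a) (Set.finite_range _).bddAbove a
  have hone : ∀ f g s, T f s - T g s ≤ γ * dist f g := fun f g s => by
    rw [sub_le_iff_le_add]
    refine ciSup_le fun a => ?_
    have h2 := actionValue_sub_le (R := R) (R' := R) hq h0 (f := f) (g := g) (c := dist f g) (d := 0)
      (fun s a => by simp) (fun s => (le_abs_self _).trans (dist_le_pi_dist f g s)) s a
    linarith [hle g s a]
  have hT : ContractingWith ⟨γ, h0⟩ T := by
    refine ⟨by exact_mod_cast h1, LipschitzWith.of_dist_le_mul fun f g => ?_⟩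
    refine (dist_pi_le_iff (mul_nonneg h0 dist_nonneg)).2 fun s => abs_le.2 ⟨?_, hone f g s⟩
    have := hone g f s
    rw [dist_comm] at this
    change -(γ * dist f g) ≤ _
    linarith
  refine ⟨ContractingWith.fixedPoint T hT, fun s => ?_⟩
  have hfix : T _ s = _ := congrFun hT.fixedPoint_isFixedPt s
  constructor
  · obtain ⟨a, ha⟩ := exists_eq_ciSup_of_finite
      (f := fun a => actionValue γ R q (ContractingWith.fixedPoint T hT) s a)
    exact ⟨a, ha.trans hfix⟩
  · rintro _ ⟨a, rfl⟩
    exact (hle _ s a).trans hfix.le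

theorem IsBellmanSolution.bounds {R : S → A → ℝ} {q : S → A → S → ℝ}
    (hq : ∀ s a, q s a ∈ stdSimplex ℝ S) (h0 : 0 ≤ γ) (h1 : γ < 1) {v : S → ℝ} {ρ : ℝ}
    (hv : IsBellmanSolution γ R q v) (hR0 : ∀ s a, 0 ≤ R s a) (hR1 : ∀ s a, R s a ≤ ρ) (s : S) :
    0 ≤ v s ∧ v s ≤ (1 - γ)⁻¹ * ρ := by
  have hH : 0 < 1 - γ := by linarith
  obtain ⟨a₀, -⟩ := (hv s).1
  have : Nonempty A := ⟨a₀⟩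
  have hz : IsBellmanSolution γ (fun _ _ => 0) q 0 := fun s =>
    ⟨⟨a₀, by simp [actionValue]⟩, by rintro _ ⟨a, rfl⟩; simp [actionValue]⟩
  have h2 := hv.sub_le hq h0 h1 hz (d := ρ) (by simpa using hR1) s
  have h3 := hz.sub_le hq h0 h1 hv (d := 0) (by simpa using hR0) s
  simp only [Pi.zero_apply, mul_zero, sub_zero] at h2 h3
  exact ⟨by linarith, h2⟩

variable [DecidableEq S]

/-- The transition matrix of the policy `π`. -/
def policyMatrix (p : S → A → S → ℝ) (π : S → A) : Matrix S S ℝ := fun s => p s (π s)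

theorem policyMatrix_mem {p : S → A → S → ℝ} (hp : ∀ s a, p s a ∈ stdSimplex ℝ S) (π : S → A) :
    policyMatrix p π ∈ Matrix.rowStochastic ℝ S :=
  Matrix.mem_rowStochastic_iff_sum.2 ⟨fun s => (hp s (π s)).1, fun s => (hp s (π s)).2⟩

/-- The discounted value of the policy `π`, through the resolvent. -/
noncomputable def policyValue (γ : ℝ) (R : S → A → ℝ) (p : S → A → S → ℝ) (π : S → A) : S → ℝ :=
  discResolvent γ (policyMatrix p π) fun s => R s (π s)

theorem policyValue_eq {p : S → A → S → ℝ} (hp : ∀ s a, p s a ∈ stdSimplex ℝ S) (h0 : 0 ≤ γ)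
    (h1 : γ < 1) (R : S → A → ℝ) (π : S → A) :
    policyValue γ R p π =
      (fun s => R s (π s)) + γ • (policyMatrix p π *ᵥ policyValue γ R p π) :=
  resolvent_eq (policyMatrix_mem hp π) h0 h1 _

theorem exists_optimal_policy [Finite A] [Nonempty A] {p : S → A → S → ℝ}
    (hp : ∀ s a, p s a ∈ stdSimplex ℝ S) (h0 : 0 ≤ γ) (h1 : γ < 1) (R : S → A → ℝ) :
    ∃ π₀ : S → A, ∀ π, policyValue γ R p π ≤ policyValue γ R p π₀ := by
  obtain ⟨v, hv⟩ := exists_isBellmanSolution R hp h0 h1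
  choose π₀ hπ₀ using fun s => (hv s).1
  refine ⟨π₀, fun π => ?_⟩
  have h2 : v = policyValue γ R p π₀ :=
    eq_resolvent (policyMatrix_mem hp π₀) h0 h1 (funext fun s => (hπ₀ s).symm)
  rw [← h2]
  exact resolvent_le (policyMatrix_mem hp π) h0 h1 fun s => (hv s).2 ⟨π s, rfl⟩

/-- The suboptimality of a policy that is greedy for a perturbed kernel `q`, when the one-step errors
satisfy a Bernstein-type bound at the solution `u` of the perturbed Bellman equation. -/
theorem policyValue_sub_le_of_greedy [Finite A] {p q : S → A → S → ℝ}
    (hp : ∀ s a, p s a ∈ stdSimplex ℝ S)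
    (h0 : 1 / 2 ≤ γ) (h1 : γ < 1) {R : S → A → ℝ} {t l c : ℝ} (hR0 : ∀ s a, 0 ≤ R s a)
    (hR1 : ∀ s a, R s a ≤ 3 / 2) (ht0 : 0 ≤ t) (ht : t ≤ (1 - γ)⁻¹) (hc : 0 ≤ c)
    (hT : ∀ π a b, policyValue γ R p π a - policyValue γ R p π b ≤ 3 / 2 * t)
    (hl0 : 0 ≤ l) (hl : 128 * l * (1 - γ)⁻¹ ≤ 1) {u : S → ℝ} (hu : IsBellmanSolution γ R q u)
    {π' : S → A} (hπ' : ∀ s a, actionValue γ R q u s a ≤ actionValue γ R q u s (π' s))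
    (he : ∀ s a, |q s a ⬝ᵥ u - p s a ⬝ᵥ u| ≤ 2 * √l * wsd (p s a) u + l * osc u + c)
    (π : S → A) (s : S) :
    policyValue γ R p π s - policyValue γ R p π' s ≤
      40 * ((1 - γ)⁻¹ * √(l * t)) + 6 * ((1 - γ)⁻¹ * c) := by
  have hγ : 0 ≤ γ := by linarith
  have hH : 0 < (1 - γ)⁻¹ := inv_pos.2 (by linarith)
  have hS : Nonempty S := ⟨s⟩
  have : Nonempty A := ⟨π s⟩
  obtain ⟨π₀, hπ₀⟩ := exists_optimal_policy hp hγ h1 R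
  set B := (1 - γ)⁻¹ * √(l * t) with hB
  have hB0 : 0 ≤ B := by positivity
  have hc0 : 0 ≤ (1 - γ)⁻¹ * c := by positivity
  -- Sampling error and Bellman gap of a policy: the sources of the equation for `u` minus its
  -- value.
  let e : (S → A) → S → ℝ := fun π s => γ * (q s (π s) ⬝ᵥ u - p s (π s) ⬝ᵥ u)
  let g : (S → A) → S → ℝ := fun π s => u s - actionValue γ R q u s (π s)
  have hg : ∀ π s, 0 ≤ g π s := fun π s => sub_nonneg.2 ((hu s).2 ⟨π s, rfl⟩)
  have hg' : g π' = 0 := by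
    ext s
    obtain ⟨a, ha⟩ := (hu s).1
    refine le_antisymm (sub_nonpos.2 ?_) (hg π' s)
    exact ha.symm.le.trans (hπ' s a)
  have he' : ∀ π s, |e π s| ≤ 2 * √l * wsd (policyMatrix p π s) u + l * osc u + c := fun π s => by
    simp only [e]
    rw [abs_mul, abs_of_nonneg hγ]
    exact (mul_le_of_le_one_left (abs_nonneg _) h1.le).trans (he s (π s))
  have hD : ∀ π, u - policyValue γ R p π =
      e π + g π + γ • (policyMatrix p π *ᵥ (u - policyValue γ R p π)) := fun π => by
    ext s
    have h2 := congrFun (policyValue_eq hp hγ h1 R π) s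
    have h3 : ∀ f, (policyMatrix p π *ᵥ f) s = p s (π s) ⬝ᵥ f := fun _ => rfl
    have h4 : actionValue γ R q u s (π s) = R s (π s) + γ * (q s (π s) ⬝ᵥ u) := rfl
    simp only [Pi.add_apply, Pi.smul_apply, smul_eq_mul, h3, Pi.sub_apply, dotProduct_sub, e, g,
      h4] at h2 ⊢
    linarith
  have hcontract := fun (π : S → A) (M : ℝ) => resolvent_abs_error_le (M := M)
    (policyMatrix_mem hp π) h0 h1 (policyValue_eq hp hγ h1 R π) (fun s => hR0 s _)
    (fun s => hR1 s _) ht0 ht (hT π) hl0 hl (hD π) (hg π) (he' π)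
  have hDeq : ∀ π s, u s - policyValue γ R p π s =
      discResolvent γ (policyMatrix p π) (e π) s + discResolvent γ (policyMatrix p π) (g π) s :=
    fun π s => by
      have := congrFun (eq_resolvent (policyMatrix_mem hp π) hγ h1 (hD π)) s
      rwa [resolvent_add] at this
  have hKe := fun π s => abs_le.1 (abs_resolvent_le (policyMatrix_mem hp π) hγ h1 (e π) s)
  -- the greedy policy
  obtain ⟨x, hx⟩ := Finite.exists_max (discResolvent γ (policyMatrix p π') fun s => |e π' s|)
  set F := discResolvent γ (policyMatrix p π') (fun s => |e π' s|) x with hF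
  have hDF : ∀ s, |u s - policyValue γ R p π' s| ≤ F := fun s => by
    have h2 := hDeq π' s
    have h3 : discResolvent γ (policyMatrix p π') 0 s = 0 := by simp [discResolvent]
    rw [hg', h3, add_zero] at h2
    rw [h2]
    exact (abs_resolvent_le (policyMatrix_mem hp π') hγ h1 (e π') s).trans (hx s)
  have hosc : osc u ≤ 3 / 2 * t + 2 * F := osc_le fun a b => by
    linarith [hT π' a b, (abs_le.1 (hDF a)).2, (abs_le.1 (hDF b)).1]
  -- As the gap vanishes for `π'`, the accumulated error `F` itself is an admissible `M`. This
  -- yields `F ≤ 7 B + 16/25 F + (1 - γ)⁻¹ c`, hence `F ≤ 20 B + 3 (1 - γ)⁻¹ c`.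
  have hF2 := hcontract π' F hx (fun s => (abs_le.1 (hDF s)).2) hosc x
  rw [← hF, ← hB] at hF2
  -- the optimal policy
  obtain ⟨y, hy⟩ := Finite.exists_max (discResolvent γ (policyMatrix p π₀) fun s => |e π₀ s|)
  set G := discResolvent γ (policyMatrix p π₀) (fun s => |e π₀ s|) y with hG
  -- The gap of `π₀` need not vanish, but optimality gives `u - v^π₀ ≤ u - v^π' ≤ F`, and `osc u` is
  -- already controlled through `F`; so `max F G` is admissible.
  have hG2 := hcontract π₀ (max F G) (fun s => (hy s).trans (le_max_right _ _))
    (fun s => by linarith [(abs_le.1 (hDF s)).2, hπ₀ π' s, le_max_left F G])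
    (hosc.trans (by linarith [le_max_left F G])) y
  rw [← hG, ← hB] at hG2
  have hGF : G ≤ 20 * B + 3 * ((1 - γ)⁻¹ * c) := by
    rcases max_cases F G with ⟨h, -⟩ | ⟨h, -⟩ <;> rw [h] at hG2 <;> linarith
  have hlow : policyValue γ R p π₀ s - u s ≤ G := by
    have h2 := hDeq π₀ s
    have h3 := resolvent_nonneg (policyMatrix_mem hp π₀) hγ h1 (hg π₀) s
    simp only [Pi.zero_apply] at h3
    linarith [(hKe π₀ s).1, hy s]
  linarith [hπ₀ π s, (abs_le.1 (hDF s)).2]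

end Bellman

/-! ### Trajectory values as resolvents. -/

theorem PMF.toReal_mem_stdSimplex {S : Type*} [Fintype S] (ψ : PMF S) :
    (fun s => (ψ s).toReal) ∈ stdSimplex ℝ S := by
  refine ⟨fun _ => ENNReal.toReal_nonneg, ?_⟩
  rw [← ENNReal.toReal_sum fun s _ => ψ.apply_ne_top s, ← tsum_fintype (L := .unconditional _),
    ψ.tsum_coe]
  simp

/-- The partial sums telescope to `K - γ ^ m P ^ m K`, where `K` is the resolvent of `r`. -/
theorem hasSum_discResolvent {S : Type*} [Fintype S] [DecidableEq S] {P : Matrix S S ℝ} {γ : ℝ}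
    (hP : P ∈ Matrix.rowStochastic ℝ S) (h0 : 0 ≤ γ) (h1 : γ < 1) {r : S → ℝ}
    (hr0 : ∀ s, 0 ≤ r s) (s : S) :
    HasSum (fun t : ℕ => γ ^ t * (P ^ t *ᵥ r) s) (discResolvent γ P r s) := by
  set K := discResolvent γ P r with hK
  have hKeq : K = r + γ • (P *ᵥ K) := resolvent_eq hP h0 h1 r
  have hK0 : 0 ≤ K := resolvent_nonneg hP h0 h1 hr0
  have : Nonempty S := ⟨s⟩
  obtain ⟨x, hx⟩ := Finite.exists_max K
  have hpart : ∀ m : ℕ, ∑ t ∈ Finset.range m, γ ^ t * (P ^ t *ᵥ r) s =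
      K s - γ ^ m * (P ^ m *ᵥ K) s := fun m => by
    induction m with
    | zero => simp
    | succ m ih =>
      rw [Finset.sum_range_succ, ih]
      have h2 : (P ^ m *ᵥ K) s = (P ^ m *ᵥ r) s + γ * (P ^ (m + 1) *ᵥ K) s := by
        conv_lhs => rw [hKeq]
        rw [Matrix.mulVec_add, Matrix.mulVec_smul, Matrix.mulVec_mulVec, ← pow_succ]
        rfl
      rw [h2]
      ring
  have hb0 : ∀ m : ℕ, 0 ≤ (P ^ m *ᵥ K) s := fun m =>
    le_dotProduct_of_mem_stdSimplex (row_mem_stdSimplex (pow_mem hP m) s) hK0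
  have hb1 : ∀ m : ℕ, (P ^ m *ᵥ K) s ≤ K x := fun m =>
    dotProduct_le_of_mem_stdSimplex (row_mem_stdSimplex (pow_mem hP m) s) hx
  have hterm : ∀ t : ℕ, 0 ≤ γ ^ t * (P ^ t *ᵥ r) s := fun t => mul_nonneg (pow_nonneg h0 t)
    (le_dotProduct_of_mem_stdSimplex (row_mem_stdSimplex (pow_mem hP t) s) hr0)
  rw [hasSum_iff_tendsto_nat_of_nonneg hterm]
  simp_rw [hpart]
  have hz : Filter.Tendsto (fun m : ℕ => γ ^ m * (P ^ m *ᵥ K) s) Filter.atTop (nhds 0) := by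
    have h2 := (tendsto_pow_atTop_nhds_zero_of_lt_one h0 h1).mul_const (K x)
    rw [zero_mul] at h2
    exact squeeze_zero (fun m => mul_nonneg (pow_nonneg h0 m) (hb0 m))
      (fun m => mul_le_mul_of_nonneg_left (hb1 m) (pow_nonneg h0 m)) h2
  simpa using hz.const_sub (K s)

namespace MDP

variable {S : Type u} {A : Type v} [Fintype S]

/-- The transition probabilities as real numbers. -/
noncomputable def prob (M : MDP S A) (s : S) (a : A) (s' : S) : ℝ := (M.p s a s').toReal

theorem prob_mem (M : MDP S A) (s : S) (a : A) : M.prob s a ∈ stdSimplex ℝ S :=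
  (M.p s a).toReal_mem_stdSimplex

variable [MeasurableSpace S] [DiscreteMeasurableSpace S]
  [Fintype A] [MeasurableSpace A] [DiscreteMeasurableSpace A]

instance (M : MDP S A) (π : S → A) (s : S) : IsProbabilityMeasure (M.pathLaw π s) := by
  unfold pathLaw; infer_instance

theorem integral_stepKernel (M : MDP S A) (π : S → A) (f : S × A → ℝ) (x : S × A) :
    ∫ y, f y ∂(M.stepKernel π x) = M.prob x.1 x.2 ⬝ᵥ fun s' => f (s', π s') := by
  have h : M.stepKernel π x = ((M.p x.1 x.2).map fun s' => (s', π s')).toMeasure := rfl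
  rw [h, ← PMF.toMeasure_map (p := M.p x.1 x.2) (hf := Measurable.of_discrete),
    integral_map (by fun_prop) (by fun_prop),
    PMF.integral_eq_sum]
  rfl

theorem integral_pathLaw_zero (M : MDP S A) (π : S → A) (s : S) (f : S × A → ℝ) :
    ∫ h, f (h 0) ∂(M.pathLaw π s) = f (s, π s) := by
  have hf : Measurable f := .of_discrete
  have h2 : ∫ h, f (h 0) ∂(M.pathLaw π s) =
      ∫ y, f (y ⟨0, Finset.mem_Iic.2 le_rfl⟩)
        ∂((M.pathLaw π s).map (Preorder.frestrictLe (π := fun _ => S × A) 0)) := by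
    have hm : Measurable fun y : Finset.Iic 0 → S × A => f (y ⟨0, Finset.mem_Iic.2 le_rfl⟩) :=
      hf.comp (measurable_pi_apply _)
    exact (integral_map (μ := M.pathLaw π s) (φ := Preorder.frestrictLe (π := fun _ => S × A) 0)
      (by fun_prop) (hm.stronglyMeasurable.aestronglyMeasurable)).symm
  rw [h2, pathLaw, Kernel.traj_map_frestrictLe_apply, Kernel.partialTraj_self, Kernel.id_apply,
    integral_dirac]

/-- Markov property: the law of the history to time `t` together with the next pair is a composition
product with the step kernel. -/
theorem integral_pathLaw_succ (M : MDP S A) (π : S → A) (s : S) (f : S × A → ℝ) (t : ℕ) :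
    ∫ h, f (h (t + 1)) ∂(M.pathLaw π s) =
      ∫ h, M.prob (h t).1 (h t).2 ⬝ᵥ (fun s' => f (s', π s')) ∂(M.pathLaw π s) := by
  have hf : Measurable f := .of_discrete
  have h2 : ∫ h, f (h (t + 1)) ∂(M.pathLaw π s) =
      ∫ y, f y.2 ∂((M.pathLaw π s).map
        (fun x => (Preorder.frestrictLe (π := fun _ => S × A) t x, x (t + 1)))) := by
    rw [integral_map (by fun_prop) (by fun_prop)]
  rw [h2, pathLaw, ← Kernel.partialTraj_compProd_eq_map_traj (Nat.zero_le t),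
    Measure.integral_compProd (.of_finite), ← Kernel.traj_map_frestrictLe_apply,
    integral_map (by fun_prop) (by fun_prop)]
  refine integral_congr_ae (.of_forall fun h => ?_)
  exact M.integral_stepKernel π f (h t)

variable [DecidableEq S]

theorem integral_pathLaw (M : MDP S A) (π : S → A) (s : S) (f : S × A → ℝ) (t : ℕ) :
    ∫ h, f (h t) ∂(M.pathLaw π s) =
      (policyMatrix M.prob π ^ t *ᵥ fun s => f (s, π s)) s := by
  induction t generalizing f with
  | zero => simpa using M.integral_pathLaw_zero π s f
  | succ t ih =>
    rw [integral_pathLaw_succ, ih fun x => M.prob x.1 x.2 ⬝ᵥ fun s' => f (s', π s'), pow_succ,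
      ← Matrix.mulVec_mulVec]
    rfl

theorem value_eq_policyValue (M : MDP S A) {γ : ℝ} (h0 : 0 ≤ γ) (h1 : γ < 1) (π : S → A) (s : S) :
    M.value γ π s = policyValue γ M.r M.prob π s := by
  have hbd : ∀ x : S × A, ‖M.r x.1 x.2‖ ≤ 1 := fun x => by
    rw [Real.norm_eq_abs, abs_of_nonneg (M.r_nonneg _ _)]
    exact M.r_le_one _ _
  have hint : ∀ t : ℕ, ∫ h, γ ^ t * M.r (h t).1 (h t).2 ∂(M.pathLaw π s) =
      γ ^ t * (policyMatrix M.prob π ^ t *ᵥ fun s => M.r s (π s)) s := fun t => by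
    rw [integral_const_mul]
    congr 1
    exact M.integral_pathLaw π s (fun x => M.r x.1 x.2) t
  have hmeas : ∀ t : ℕ, Measurable fun h : ℕ → S × A => M.r (h t).1 (h t).2 := fun t =>
    (Measurable.of_discrete (f := fun x : S × A => M.r x.1 x.2)).comp (measurable_pi_apply t)
  have hsum := hasSum_discResolvent (policyMatrix_mem M.prob_mem π) h0 h1
    (r := fun s => M.r s (π s)) (fun s => M.r_nonneg _ _) s
  refine HasSum.unique ?_ hsum
  simp_rw [← hint]
  refine hasSum_integral_of_summable_integral_norm (fun t => ?_) ?_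
  · refine Integrable.const_mul (Integrable.of_bound (hmeas t).aestronglyMeasurable 1
      (.of_forall fun h => hbd (h t))) _
  · refine hsum.summable.congr fun t => ?_
    rw [← hint]
    refine integral_congr_ae (.of_forall fun h => ?_)
    simp only
    rw [Real.norm_of_nonneg (mul_nonneg (pow_nonneg h0 t) (M.r_nonneg _ _))]

end MDP

/-! ### Bernstein's inequality and empirical means. -/

section Bernstein

variable {Ω : Type*} [MeasurableSpace Ω] {μ : Measure Ω} [IsProbabilityMeasure μ]

/-- Integrate `exp x ≤ 1 + x + x²`, valid for `|x| ≤ 1`. -/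
theorem mgf_le_exp_sq_mul {Y : Ω → ℝ} (hY : Measurable Y) {M θ : ℝ} (hbd : ∀ ω, |Y ω| ≤ M)
    (hmean : ∫ ω, Y ω ∂μ = 0) (hθ : 0 ≤ θ) (hθM : θ * M ≤ 1) :
    mgf Y μ θ ≤ Real.exp (θ ^ 2 * ∫ ω, Y ω ^ 2 ∂μ) := by
  have hint : Integrable Y μ :=
    Integrable.of_bound hY.aestronglyMeasurable M (.of_forall fun ω => hbd ω)
  have hint2 : Integrable (fun ω => Y ω ^ 2) μ :=
    Integrable.of_bound (hY.pow_const 2).aestronglyMeasurable (M ^ 2) (.of_forall fun ω => by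
      rw [norm_pow]
      exact pow_le_pow_left₀ (norm_nonneg _) (hbd ω) 2)
  have habs : ∀ ω, |θ * Y ω| ≤ 1 := fun ω => by
    rw [abs_mul, abs_of_nonneg hθ]
    exact (mul_le_mul_of_nonneg_left (hbd ω) hθ).trans hθM
  have hexp : Integrable (fun ω => Real.exp (θ * Y ω)) μ :=
    Integrable.of_bound (by fun_prop) (Real.exp 1) (.of_forall fun ω => by
      rw [Real.norm_eq_abs, Real.abs_exp]
      exact Real.exp_le_exp.2 (le_of_abs_le (habs ω)))
  calc mgf Y μ θ ≤ ∫ ω, (1 + θ * Y ω + θ ^ 2 * Y ω ^ 2) ∂μ := by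
        refine integral_mono hexp
          (((integrable_const 1).add (hint.const_mul θ)).add (hint2.const_mul _)) fun ω => ?_
        have h := (abs_le.1 (Real.abs_exp_sub_one_sub_id_le (habs ω))).2
        simp only
        linarith [mul_pow θ (Y ω) 2]
    _ = 1 + θ ^ 2 * ∫ ω, Y ω ^ 2 ∂μ := by
        have hlin : Integrable (fun ω => 1 + θ * Y ω) μ :=
          (integrable_const 1).add (hint.const_mul θ)
        rw [integral_add hlin (hint2.const_mul _),
          integral_add (integrable_const 1) (hint.const_mul θ), integral_const_mul,
          integral_const_mul, hmean]
        simp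
    _ ≤ _ := by
        rw [add_comm]
        exact Real.add_one_le_exp _

/-- A Bernstein inequality for independent, bounded, centred random variables. -/
theorem measure_sum_ge_le_bernstein {ι : Type*} [Fintype ι] {Y : ι → Ω → ℝ}
    (hY : ∀ i, Measurable (Y i)) (hind : iIndepFun Y μ) {M V L : ℝ} (hM : 0 < M)
    (hbd : ∀ i ω, |Y i ω| ≤ M) (hmean : ∀ i, ∫ ω, Y i ω ∂μ = 0)
    (hV : ∑ i, ∫ ω, Y i ω ^ 2 ∂μ = V) (hL : 0 ≤ L) :
    μ.real {ω | 2 * √(V * L) + M * L ≤ ∑ i, Y i ω} ≤ Real.exp (-L) := by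
  rcases hL.eq_or_lt with rfl | hL
  · simp [measureReal_le_one]
  have hV0 : 0 ≤ V := hV ▸ Finset.sum_nonneg fun i _ => integral_nonneg fun ω => sq_nonneg _
  -- Chernoff's bound at `θ`; it remains to choose `θ`.
  have key : ∀ θ, 0 ≤ θ → θ * M ≤ 1 →
      L + θ ^ 2 * V ≤ θ * (2 * √(V * L) + M * L) →
      μ.real {ω | 2 * √(V * L) + M * L ≤ ∑ i, Y i ω} ≤ Real.exp (-L) := fun θ h0 h1 h2 => by
    have hmgf : mgf (fun ω => ∑ i, Y i ω) μ θ ≤ Real.exp (θ ^ 2 * V) := by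
      have h3 : (fun ω => ∑ i, Y i ω) = ∑ i, Y i := by ext ω; simp
      rw [h3, hind.mgf_sum hY, ← hV, Finset.mul_sum, Real.exp_sum]
      exact Finset.prod_le_prod (fun i _ => mgf_nonneg)
        fun i _ => mgf_le_exp_sq_mul (hY i) (hbd i) (hmean i) h0 h1
    have hint : Integrable (fun ω => Real.exp (θ * ∑ i, Y i ω)) μ := by
      refine Integrable.of_bound (by fun_prop) (Real.exp (θ * ∑ _ : ι, M)) (.of_forall fun ω => ?_)
      rw [Real.norm_eq_abs, Real.abs_exp]
      exact Real.exp_le_exp.2 (mul_le_mul_of_nonneg_left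
        (Finset.sum_le_sum fun i _ => le_of_abs_le (hbd i ω)) h0)
    refine (measure_ge_le_exp_mul_mgf (X := fun ω => ∑ i, Y i ω) _ h0 hint).trans ?_
    refine (mul_le_mul_of_nonneg_left hmgf (Real.exp_nonneg _)).trans ?_
    rw [← Real.exp_add]
    exact Real.exp_le_exp.2 (by linarith)
  rw [Real.sqrt_mul hV0] at *
  have ha := Real.sq_sqrt hV0
  have hb := Real.sq_sqrt hL.le
  have ha0 := Real.sqrt_nonneg V
  have hb0 := Real.sqrt_pos.2 hL
  set a := √V
  set b := √L
  -- Take `θ = √(L / V)` when this respects `θ M ≤ 1`, and `θ = 1 / M` otherwise; the second case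
  -- includes `V = 0`.
  rcases le_total (M * b) a with h | h
  · have ha1 : 0 < a := (mul_pos hM hb0).trans_le h
    refine key (b / a) (by positivity) ?_ ?_
    · rw [div_mul_eq_mul_div, div_le_one ha1]; linarith
    · rw [← ha, ← hb]
      have e1 : b ^ 2 + (b / a) ^ 2 * a ^ 2 = 2 * b ^ 2 := by field_simp; ring
      have e2 : b / a * (2 * (a * b) + M * b ^ 2) = 2 * b ^ 2 + b / a * (M * b ^ 2) := by
        field_simp
      rw [e1, e2]
      have : 0 ≤ b / a * (M * b ^ 2) := by positivity
      linarith
  · refine key M⁻¹ (by positivity) (inv_mul_cancel₀ hM.ne').le ?_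
    rw [← ha, ← hb]
    have e1 : M⁻¹ * (2 * (a * b) + M * b ^ 2) = b ^ 2 + M⁻¹ ^ 2 * (2 * a * (M * b)) := by
      field_simp; ring
    rw [e1]
    have : M⁻¹ ^ 2 * a ^ 2 ≤ M⁻¹ ^ 2 * (2 * a * (M * b)) :=
      mul_le_mul_of_nonneg_left (by nlinarith) (by positivity)
    linarith

end Bernstein

theorem abs_sub_dotProduct_le_osc {S : Type*} [Fintype S] {p : S → ℝ} (hp : p ∈ stdSimplex ℝ S)
    (f : S → ℝ) (s : S) :
    |f s - p ⬝ᵥ f| ≤ osc f := by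
  have h1 : p ⬝ᵥ f ≤ f s + osc f :=
    dotProduct_le_of_mem_stdSimplex hp fun x => by linarith [sub_le_osc f x s]
  have h2 : f s - osc f ≤ p ⬝ᵥ f :=
    le_dotProduct_of_mem_stdSimplex hp fun x => by linarith [sub_le_osc f s x]
  exact abs_le.2 ⟨by linarith, by linarith⟩

theorem osc_neg {S : Type*} (f : S → ℝ) : osc (-f) = osc f := by
  unfold osc
  rw [← (Equiv.prodComm S S).iSup_comp]
  congr 1
  ext x
  simp only [Equiv.prodComm_apply, Prod.fst_swap, Prod.snd_swap, Pi.neg_apply]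
  ring

theorem wsd_neg {S : Type*} [Fintype S] (p f : S → ℝ) : wsd p (-f) = wsd p f := by
  unfold wsd wvar
  simp [dotProduct_neg]

section EmpiricalMean

variable {S : Type*} [Fintype S] [MeasurableSpace S] [DiscreteMeasurableSpace S]

variable {ι : Type*} [Fintype ι] (ψ : ι → PMF S) {n : ℕ} {j : Fin n → ι}

theorem measure_empirical_sub_gt_le (hn : 1 ≤ n) (hj : Function.Injective j) {ψ₀ : PMF S}
    (hψ : ∀ i, ψ (j i) = ψ₀) (f : S → ℝ) {L : ℝ} (hL : 0 ≤ L) :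
    (Measure.pi fun k => (ψ k).toMeasure).real {x |
      2 * √(L / n) * wsd (fun s => (ψ₀ s).toReal) f + L / n * osc f <
        1 / n * ∑ i, f (x (j i)) - (fun s => (ψ₀ s).toReal) ⬝ᵥ f} ≤ Real.exp (-L) := by
  set p : S → ℝ := fun s => (ψ₀ s).toReal with hp
  have hps : p ∈ stdSimplex ℝ S := ψ₀.toReal_mem_stdSimplex
  have hn0 : (0 : ℝ) < n := by exact_mod_cast hn
  set μ := Measure.pi fun k => (ψ k).toMeasure with hμ
  let Y : Fin n → (ι → S) → ℝ := fun i x => f (x (j i)) - p ⬝ᵥ f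
  have hYm : ∀ i, Measurable (Y i) := fun i =>
    (Measurable.of_discrete (f := fun s : S => f s - p ⬝ᵥ f)).comp (measurable_pi_apply (j i))
  have hsum : ∀ x, n * (1 / n * ∑ i, f (x (j i)) - p ⬝ᵥ f) = ∑ i, Y i x := fun x => by
    simp only [Y, Finset.sum_sub_distrib, Finset.sum_const, Finset.card_univ, Fintype.card_fin,
      nsmul_eq_mul]
    field_simp
  have hind : iIndepFun Y μ :=
    (iIndepFun_pi (μ := fun k => (ψ k).toMeasure) (X := fun _ (s : S) => f s - p ⬝ᵥ f)
      fun k => Measurable.of_discrete.aemeasurable).precomp hj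
  have hbd : ∀ i x, |Y i x| ≤ osc f := fun i x => abs_sub_dotProduct_le_osc hps f _
  have hint : ∀ i (F : S → ℝ), ∫ x, F (x (j i)) ∂μ = p ⬝ᵥ F := fun i F => by
    have hmp := measurePreserving_eval (fun k => (ψ k).toMeasure) (j i)
    have h2 := integral_map (μ := μ) hmp.measurable.aemeasurable
      (Measurable.of_discrete (f := F)).stronglyMeasurable.aestronglyMeasurable
    rw [hmp.map_eq, hψ, PMF.integral_eq_sum] at h2
    exact h2.symm
  have hmean : ∀ i, ∫ x, Y i x ∂μ = 0 := fun i => by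
    rw [hint i fun s => f s - p ⬝ᵥ f]
    have h2 := dotProduct_const_of_mem_stdSimplex hps (p ⬝ᵥ f)
    have h3 : (fun s => f s - p ⬝ᵥ f) = f - fun _ => p ⬝ᵥ f := rfl
    rw [h3, dotProduct_sub, h2, sub_self]
  have hvar : ∑ i, ∫ x, Y i x ^ 2 ∂μ = n * wvar p f := by
    have : ∀ i, ∫ x, Y i x ^ 2 ∂μ = wvar p f := fun i => by
      rw [hint i fun s => (f s - p ⬝ᵥ f) ^ 2, wvar_eq_dotProduct_sq hps]
    simp [this]
  obtain ⟨s₀⟩ : Nonempty S := ψ₀.support_nonempty.to_type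
  have hosc0 : 0 ≤ osc f := by simpa using sub_le_osc f s₀ s₀
  have hwsd := wsd_nonneg p f
  rcases hosc0.eq_or_lt with h | h
  -- Zero oscillation is separate because Bernstein's inequality needs a positive range: every
  -- deviation vanishes and the event is empty.
  · refine le_trans (le_of_eq ?_) (Real.exp_nonneg _)
    convert measureReal_empty
    refine Set.eq_empty_of_forall_notMem fun x hx => ?_
    have hY0 : ∀ i, Y i x = 0 := fun i => abs_nonpos_iff.1 (h ▸ hbd i x)
    have h2 := hsum x
    simp only [hY0, Finset.sum_const_zero] at h2
    have h3 := (mul_eq_zero.1 h2).resolve_left hn0.ne'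
    have hx' := Set.mem_ofPred_eq ▸ hx
    rw [h3, ← h] at hx'
    have : 0 ≤ 2 * √(L / n) * wsd p f := by positivity
    linarith
  · refine le_trans (measureReal_mono fun x hx => ?_)
      (measure_sum_ge_le_bernstein hYm hind h hbd hmean hvar hL)
    have hx' := (Set.mem_ofPred_eq ▸ hx)
    rw [Set.mem_ofPred_eq, ← hsum]
    have e1 : √(n * wvar p f * L) = n * (√(L / n) * wsd p f) := by
      rw [wsd, ← Real.sqrt_mul (by positivity)]
      rw [show n * wvar p f * L = (n : ℝ) ^ 2 * (L / n * wvar p f) by field_simp,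
        Real.sqrt_mul (by positivity), Real.sqrt_sq hn0.le]
    rw [e1]
    have e2 : osc f * L = n * (L / n * osc f) := by field_simp
    rw [e2]
    have := mul_le_mul_of_nonneg_left hx'.le hn0.le
    linarith

theorem measure_abs_empirical_sub_gt_le (hn : 1 ≤ n) (hj : Function.Injective j) {ψ₀ : PMF S}
    (hψ : ∀ i, ψ (j i) = ψ₀) (f : S → ℝ) {L : ℝ} (hL : 0 ≤ L) :
    (Measure.pi fun k => (ψ k).toMeasure) {x |
      2 * √(L / n) * wsd (fun s => (ψ₀ s).toReal) f + L / n * osc f <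
        |1 / n * ∑ i, f (x (j i)) - (fun s => (ψ₀ s).toReal) ⬝ᵥ f|} ≤
      ENNReal.ofReal (2 * Real.exp (-L)) := by
  have h1 := measure_empirical_sub_gt_le ψ hn hj hψ f hL
  have h2 := measure_empirical_sub_gt_le ψ hn hj hψ (-f) hL
  rw [osc_neg, wsd_neg] at h2
  rw [← ENNReal.ofReal_toReal (measure_ne_top _ _)]
  refine ENNReal.ofReal_le_ofReal ?_
  refine le_trans (measureReal_mono (fun x hx => ?_) (measure_ne_top _ _))
    ((measureReal_union_le _ _).trans ((add_le_add h1 h2).trans_eq (two_mul _).symm))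
  rcases lt_abs.1 (Set.mem_ofPred_eq ▸ hx) with h | h
  · exact Or.inl h
  · refine Or.inr ?_
    simp only [Set.mem_ofPred_eq, Pi.neg_apply, Finset.sum_neg_distrib, dotProduct_neg]
    linarith

/-- The deviation bound also holds for a random function which does not depend on the samples
averaged. -/
theorem measure_abs_empirical_sub_gt_le_of_indep (hn : 1 ≤ n) (hj : Function.Injective j)
    {ψ₀ : PMF S} (hψ : ∀ i, ψ (j i) = ψ₀) {J : ι → Prop} [DecidablePred J] (hJ : ∀ i, J (j i))
    {G : (ι → S) → S → ℝ} (hG : ∀ x x', (∀ k, ¬ J k → x k = x' k) → G x = G x')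
    {L : ℝ} (hL : 0 ≤ L) :
    (Measure.pi fun k => (ψ k).toMeasure) {x |
      2 * √(L / n) * wsd (fun s => (ψ₀ s).toReal) (G x) + L / n * osc (G x) <
        |1 / n * ∑ i, G x (x (j i)) - (fun s => (ψ₀ s).toReal) ⬝ᵥ G x|} ≤
      ENNReal.ofReal (2 * Real.exp (-L)) := by
  set B := {x : ι → S | 2 * √(L / n) * wsd (fun s => (ψ₀ s).toReal) (G x) + L / n * osc (G x) <
        |1 / n * ∑ i, G x (x (j i)) - (fun s => (ψ₀ s).toReal) ⬝ᵥ G x|} with hB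
  obtain ⟨s₀⟩ : Nonempty S := ψ₀.support_nonempty.to_type
  have hmp := measurePreserving_piEquivPiSubtypeProd (fun k => (ψ k).toMeasure) J
  have hBm : MeasurableSet B := .of_discrete
  rw [← hmp.symm.measure_preimage hBm.nullMeasurableSet,
    Measure.prod_apply_symm ((MeasurableEquiv.measurable _) hBm)]
  refine (lintegral_mono (g := fun _ => ENNReal.ofReal (2 * Real.exp (-L))) fun y => ?_).trans
    (by simp)
  set e := MeasurableEquiv.piEquivPiSubtypeProd (fun _ : ι => S) J
  have heJ : ∀ (x : {k // J k} → S) k (hk : J k), e.symm (x, y) k = x ⟨k, hk⟩ := fun x k hk => by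
    change (Equiv.piEquivPiSubtypeProd J fun _ => S).symm (x, y) k = _
    simp [hk]
  have heN : ∀ (x : {k // J k} → S) k (hk : ¬ J k), e.symm (x, y) k = y ⟨k, hk⟩ := fun x k hk => by
    change (Equiv.piEquivPiSubtypeProd J fun _ => S).symm (x, y) k = _
    simp [hk]
  -- By Fubini the coordinates outside `J` are frozen at `y`, and `G` becomes the fixed function
  -- `g`; the filler `s₀` on `J` is irrelevant.
  set g := G (e.symm (fun _ => s₀, y)) with hg
  have hGg : ∀ x, G (e.symm (x, y)) = g := fun x => hG _ _ fun k hk => by rw [heN _ k hk, heN _ k hk]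
  refine le_trans (measure_mono fun x hx => ?_)
    (measure_abs_empirical_sub_gt_le (fun k : {k // J k} => ψ k) (j := fun i => ⟨j i, hJ i⟩) hn
      (fun a b hab => hj (congrArg Subtype.val hab)) hψ g hL)
  have hx' : e.symm (x, y) ∈ B := hx
  rw [hB, Set.mem_ofPred_eq, hGg] at hx'
  simp only [heJ _ _ (hJ _)] at hx'
  exact hx'

end EmpiricalMean

/-! ### Decoupling by absorbing states, and the net of absorbed values. -/

section Absorbing

/-- A solution of the Bellman equation. -/
noncomputable def bellmanSolution {S : Type u} {A : Type v} [Fintype S] (γ : ℝ)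
    (R : S → A → ℝ) (q : S → A → S → ℝ) : S → ℝ :=
  Classical.epsilon (IsBellmanSolution γ R q)

theorem bellmanSolution_spec {S : Type u} {A : Type v} [Fintype S] {γ : ℝ} [Finite A]
    [Nonempty A] (R : S → A → ℝ) {q : S → A → S → ℝ}
    (hq : ∀ s a, q s a ∈ stdSimplex ℝ S) (h0 : 0 ≤ γ) (h1 : γ < 1) :
    IsBellmanSolution γ R q (bellmanSolution γ R q) :=
  Classical.epsilon_spec (exists_isBellmanSolution R hq h0 h1)

variable {S : Type u} {A : Type v} [DecidableEq S] {γ : ℝ}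

/-- Rewards modified so that the absorbing state `s₀` has value `c`. -/
noncomputable def absorbReward (γ : ℝ) (R : S → A → ℝ) (s₀ : S) (c : ℝ) (s : S) (a : A) : ℝ :=
  if s = s₀ then (1 - γ) * c else R s a

/-- Transition weights modified so that `s₀` is absorbing. -/
noncomputable def absorbKernel (q : S → A → S → ℝ) (s₀ s : S) (a : A) : S → ℝ :=
  if s = s₀ then Pi.single s₀ 1 else q s a

variable [Fintype S]

theorem absorbKernel_mem {q : S → A → S → ℝ} (hq : ∀ s a, q s a ∈ stdSimplex ℝ S) (s₀ s : S)
    (a : A) : absorbKernel q s₀ s a ∈ stdSimplex ℝ S := by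
  unfold absorbKernel
  split_ifs
  · exact single_mem_stdSimplex ℝ s₀
  · exact hq s a

/-- Giving `s₀` the value it already has changes nothing: `u s₀ = (1 - γ) u s₀ + γ u s₀`. -/
theorem IsBellmanSolution.absorb {R : S → A → ℝ} {q : S → A → S → ℝ} {u : S → ℝ}
    (hu : IsBellmanSolution γ R q u) (s₀ : S) :
    IsBellmanSolution γ (absorbReward γ R s₀ (u s₀)) (absorbKernel q s₀) u := by
  intro s
  by_cases h : s = s₀
  · subst h
    have h2 : ∀ a, actionValue γ (absorbReward γ R s (u s)) (absorbKernel q s) u s a = u s :=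
      fun a => by
        simp only [actionValue, absorbReward, absorbKernel, if_true, Pi.single_apply, ite_mul,
          one_mul, zero_mul, Finset.sum_ite_eq', Finset.mem_univ]
        ring
    obtain ⟨a, -⟩ := (hu s).1
    refine ⟨⟨a, h2 a⟩, ?_⟩
    rintro _ ⟨a, rfl⟩
    exact (h2 a).le
  · have h2 : ∀ a, actionValue γ (absorbReward γ R s₀ (u s₀)) (absorbKernel q s₀) u s a =
        actionValue γ R q u s a := fun a => by
      simp only [actionValue, absorbReward, absorbKernel, if_neg h]
    simp only [h2]
    exact hu s

/-- Both functions solve absorbed equations whose rewards differ only at `s₀`, by at most `(1 - γ)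
τ`, and solutions are `(1 - γ)⁻¹`-Lipschitz in the rewards. A one-dimensional net of values `c`
therefore covers `u`. -/
theorem abs_absorbed_sub_le {R : S → A → ℝ} {q : S → A → S → ℝ} [Finite A] [Nonempty A]
    (hq : ∀ s a, q s a ∈ stdSimplex ℝ S) (h0 : 0 ≤ γ) (h1 : γ < 1) {u : S → ℝ}
    (hu : IsBellmanSolution γ R q u) {s₀ : S} {c τ : ℝ} (hτ : 0 ≤ τ) (hc : |u s₀ - c| ≤ τ) (s : S) :
    |u s - bellmanSolution γ (absorbReward γ R s₀ c) (absorbKernel q s₀) s| ≤ τ := by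
  have hH : 0 < 1 - γ := by linarith
  have h2 := (hu.absorb s₀).abs_sub_le (absorbKernel_mem hq s₀) h0 h1
    (bellmanSolution_spec (absorbReward γ R s₀ c) (absorbKernel_mem hq s₀) h0 h1)
    (d := (1 - γ) * τ) (fun s a => by
      unfold absorbReward
      split_ifs
      · rw [← mul_sub, abs_mul, abs_of_pos hH]
        exact mul_le_mul_of_nonneg_left hc hH.le
      · rw [sub_self, abs_zero]; positivity) s
  rwa [inv_mul_cancel_left₀ hH.ne'] at h2

end Absorbing

section Empirical

variable {S : Type u} {A : Type v} [Fintype S] {n : ℕ}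

theorem empiricalKernel_dotProduct (x : SampleIndex S A n → S) (s : S) (a : A) (f : S → ℝ) :
    empiricalKernel x s a ⬝ᵥ f = 1 / n * ∑ i : Fin n, f (x ((s, a), i)) := by
  classical
  simp only [dotProduct, empiricalKernel, mul_assoc, Finset.sum_mul, ← Finset.mul_sum]
  rw [Finset.sum_comm]
  simp [Set.indicator_apply]

theorem empiricalKernel_mem (hn : 1 ≤ n) (x : SampleIndex S A n → S) (s : S) (a : A) :
    empiricalKernel x s a ∈ stdSimplex ℝ S := by
  have hn0 : (n : ℝ) ≠ 0 := by positivity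
  refine ⟨fun s' => mul_nonneg (by positivity) (Finset.sum_nonneg fun i _ =>
    Set.indicator_nonneg (fun _ _ => zero_le_one) _), ?_⟩
  have h := empiricalKernel_dotProduct x s a 1
  simpa [hn0, dotProduct] using h

end Empirical

section Net

variable {S : Type*} [Fintype S]

/-- Transfer of a deviation bound from `w` to a function `u` within `τ` of it. -/
theorem abs_dotProduct_sub_le_of_close {p q u w : S → ℝ} (hp : p ∈ stdSimplex ℝ S)
    (hq : q ∈ stdSimplex ℝ S) {τ l : ℝ} (hτ : 0 ≤ τ) (hl0 : 0 ≤ l) (hl : l ≤ 1 / 256)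
    (huw : ∀ s, |u s - w s| ≤ τ)
    (hw : |q ⬝ᵥ w - p ⬝ᵥ w| ≤ 2 * √l * wsd p w + l * osc w) :
    |q ⬝ᵥ u - p ⬝ᵥ u| ≤ 2 * √l * wsd p u + l * osc u + 3 * τ := by
  obtain ⟨s⟩ : Nonempty S := by
    by_contra h
    rw [not_nonempty_iff] at h
    simpa using hp.2
  have : Nonempty S := ⟨s⟩
  have b : ∀ p' ∈ stdSimplex ℝ S, |p' ⬝ᵥ u - p' ⬝ᵥ w| ≤ τ := fun p' hp' => by
    rw [← dotProduct_sub]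
    exact abs_le.2 ⟨le_dotProduct_of_mem_stdSimplex hp' fun s => (abs_le.1 (huw s)).1,
      dotProduct_le_of_mem_stdSimplex hp' fun s => (abs_le.1 (huw s)).2⟩
  have h1 : |q ⬝ᵥ u - p ⬝ᵥ u| ≤ |q ⬝ᵥ w - p ⬝ᵥ w| + 2 * τ := by
    have e : q ⬝ᵥ u - p ⬝ᵥ u =
        (q ⬝ᵥ w - p ⬝ᵥ w) + ((q ⬝ᵥ u - q ⬝ᵥ w) - (p ⬝ᵥ u - p ⬝ᵥ w)) := by ring
    rw [e]
    refine (abs_add_le _ _).trans (add_le_add le_rfl ((abs_sub _ _).trans ?_))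
    linarith [b q hq, b p hp]
  have h2 : wsd p w ≤ wsd p u + τ := by
    have := wsd_add_le hp u (w - u)
    rw [add_sub_cancel] at this
    refine this.trans (add_le_add le_rfl (wsd_le hp hτ fun s => ?_))
    rw [Pi.sub_apply, abs_sub_comm]
    exact huw s
  have h3 : osc w ≤ osc u + 2 * τ := osc_le fun x y => by
    linarith [(abs_le.1 (huw x)).1, (abs_le.1 (huw y)).2, sub_le_osc u x y]
  have h4 : √l ≤ 1 / 16 := Real.sqrt_le_iff.2 ⟨by norm_num, by linarith⟩
  have h5 : 2 * √l * wsd p w ≤ 2 * √l * wsd p u + 1 / 8 * τ := by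
    have := mul_le_mul_of_nonneg_left h2 (by positivity : 0 ≤ 2 * √l)
    nlinarith [mul_le_mul_of_nonneg_right h4 hτ]
  have h6 : l * osc w ≤ l * osc u + 1 / 128 * τ := by
    have := mul_le_mul_of_nonneg_left h3 hl0
    nlinarith [mul_le_mul_of_nonneg_right hl hτ]
  -- Total loss: `2 τ + τ/8 + τ/128 ≤ 3 τ`.
  linarith

end Net

section Continuity

variable {S : Type*} [Fintype S]

theorem continuous_wsd (p : S → ℝ) : Continuous (wsd p) := by
  unfold wsd wvar dotProduct
  fun_prop

theorem measurable_osc : Measurable (osc : (S → ℝ) → ℝ) := by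
  unfold osc
  exact Measurable.iSup fun x => by fun_prop

end Continuity

namespace MDP

variable {S : Type u} {A : Type v} [Fintype S] [DecidableEq S]

/-- The value of the empirical model in which `s₀` is absorbing with value `c`. -/
noncomputable def absorbedValue (M : MDP S A) (γ : ℝ) {n : ℕ} (s₀ : S) (c : ℝ)
    (y : (S × A → ℝ) × (SampleIndex S A n → S)) : S → ℝ :=
  bellmanSolution γ (absorbReward γ (fun s a => M.r s a + y.1 (s, a)) s₀ c)
    (absorbKernel (empiricalKernel y.2) s₀)

/-- The samples at `(s, a)` violate a Bernstein-type bound for the value with `s` absorbing. -/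
noncomputable def deviationSet (M : MDP S A) (γ l : ℝ) (n : ℕ) (s : S) (a : A) (c : ℝ) :
    Set ((S × A → ℝ) × (SampleIndex S A n → S)) :=
  {y | 2 * √l * wsd (M.prob s a) (M.absorbedValue γ s c y) + l * osc (M.absorbedValue γ s c y) <
    |empiricalKernel y.2 s a ⬝ᵥ M.absorbedValue γ s c y -
      M.prob s a ⬝ᵥ M.absorbedValue γ s c y|}

variable [Fintype A] [Nonempty A] {n : ℕ} {γ : ℝ}

/-- Supplies measurability in the perturbation; the samples range over a finite discrete set. -/
theorem continuous_absorbedValue (M : MDP S A) (hn : 1 ≤ n) (h0 : 0 ≤ γ) (h1 : γ < 1) (s₀ : S)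
    (c : ℝ) (x : SampleIndex S A n → S) :
    Continuous fun z : S × A → ℝ => M.absorbedValue γ s₀ c (z, x) := by
  have hH : 0 < (1 - γ)⁻¹ := inv_pos.2 (by linarith)
  refine LipschitzWith.continuous (K := ⟨(1 - γ)⁻¹, hH.le⟩)
    (LipschitzWith.of_dist_le_mul fun z z' => ?_)
  have hq := absorbKernel_mem (empiricalKernel_mem (A := A) hn x) s₀
  refine (dist_pi_le_iff (mul_nonneg hH.le dist_nonneg)).2 fun s => ?_
  refine (bellmanSolution_spec _ hq h0 h1).abs_sub_le hq h0 h1 (bellmanSolution_spec _ hq h0 h1)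
    (fun s a => ?_) s
  unfold absorbReward
  split_ifs
  · simp
  · rw [add_sub_add_left_eq_sub]
    exact dist_le_pi_dist z z' (s, a)

variable [MeasurableSpace S] [DiscreteMeasurableSpace S]

theorem measurableSet_deviationSet (M : MDP S A) (hn : 1 ≤ n) (h0 : 0 ≤ γ) (h1 : γ < 1) (l : ℝ)
    (s : S) (a : A) (c : ℝ) : MeasurableSet (M.deviationSet γ l n s a c) := by
  have hW : Measurable fun y : (S × A → ℝ) × (SampleIndex S A n → S) =>
      M.absorbedValue γ s c y :=
    measurable_from_prod_countable_left fun x =>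
      (M.continuous_absorbedValue hn h0 h1 s c x).measurable
  have hE : Measurable fun y : (S × A → ℝ) × (SampleIndex S A n → S) =>
      empiricalKernel y.2 s a :=
    (Measurable.of_discrete (f := fun x : SampleIndex S A n → S =>
      empiricalKernel x s a)).comp measurable_snd
  refine measurableSet_lt ?_ ?_
  · exact (((continuous_wsd _).measurable.comp hW).const_mul _).add
      ((measurable_osc.comp hW).const_mul _)
  · have hd : Measurable fun y : (S → ℝ) × (S → ℝ) => y.1 ⬝ᵥ y.2 := by
      unfold dotProduct
      fun_prop
    exact ((hd.comp (hE.prodMk hW)).sub (hd.comp (measurable_const.prodMk hW))).abs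

theorem pmbpLaw_deviationSet_le (M : MDP S A) (hn : 1 ≤ n) (h0 : 0 ≤ γ) (h1 : γ < 1) {ζ : ℝ}
    (hζ : 0 < ζ) {L : ℝ} (hL : 0 ≤ L) (s : S) (a : A) (c : ℝ) :
    M.pmbpLaw ζ n (M.deviationSet γ (L / n) n s a c) ≤ ENNReal.ofReal (2 * Real.exp (-L)) := by
  have : IsProbabilityMeasure (ProbabilityTheory.cond volume (Set.Icc 0 ζ)) :=
    cond_isProbabilityMeasure_of_finite (by simp [hζ]) (by simp)
  rw [pmbpLaw, Measure.prod_apply (M.measurableSet_deviationSet hn h0 h1 _ s a c)]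
  refine (lintegral_mono (g := fun _ => ENNReal.ofReal (2 * Real.exp (-L))) fun z => ?_).trans
    (by simp)
  -- With the perturbation fixed, the absorbed value ignores the samples at `s` for every action, so
  -- `J` selects all of them and not only those at `(s, a)`.
  have key := measure_abs_empirical_sub_gt_le_of_indep
    (fun k : SampleIndex S A n => M.p k.1.1 k.1.2) (j := fun i => ((s, a), i)) hn
    (fun i i' h => (Prod.ext_iff.1 h).2) (ψ₀ := M.p s a) (fun _ => rfl)
    (J := fun k => k.1.1 = s) (fun _ => rfl)
    (G := fun x => M.absorbedValue γ s c (z, x)) (fun x x' h => ?_) hL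
  · refine le_trans (measure_mono fun x hx => ?_) key
    have hx' : (z, x) ∈ M.deviationSet γ (L / n) n s a c := hx
    rw [deviationSet, Set.mem_ofPred_eq, empiricalKernel_dotProduct] at hx'
    exact hx'
  · unfold absorbedValue
    congr 1
    ext s' a' s''
    unfold absorbKernel
    split_ifs with hs
    · rfl
    · simp only [empiricalKernel]
      congr 1
      exact Finset.sum_congr rfl fun i _ => by rw [h ((s', a'), i) hs]

end MDP

/-! ### The good event and its consequences. -/

namespace MDP

section Law

variable {S : Type u} {A : Type v} [Fintype S] [Fintype A] [MeasurableSpace S] {n : ℕ} {γ ζ : ℝ}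

theorem isProbabilityMeasure_pmbpLaw (M : MDP S A) (hζ : 0 < ζ) :
    IsProbabilityMeasure (M.pmbpLaw ζ n) := by
  have : IsProbabilityMeasure (ProbabilityTheory.cond volume (Set.Icc 0 ζ)) :=
    cond_isProbabilityMeasure_of_finite (by simp [hζ]) (by simp)
  unfold pmbpLaw
  infer_instance

theorem pmbpLaw_box (M : MDP S A) (hζ : 0 < ζ) :
    M.pmbpLaw ζ n ((Set.univ.pi fun _ => Set.Icc 0 ζ) ×ˢ Set.univ) = 1 := by
  have : IsProbabilityMeasure (ProbabilityTheory.cond volume (Set.Icc 0 ζ)) :=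
    cond_isProbabilityMeasure_of_finite (by simp [hζ]) (by simp)
  rw [pmbpLaw, Measure.prod_prod, Measure.pi_pi, measure_univ, mul_one]
  refine Finset.prod_eq_one fun _ _ => cond_apply_self (by simp [hζ]) (by simp)

variable [DiscreteMeasurableSpace S] [MeasurableSpace A] [DiscreteMeasurableSpace A]

/-- The preimage of `B` is only null-measurable, so it is shrunk to a measurable subset of equal
measure. The bound on `B` holds for every possible output, so `πhat` may be any function. -/
theorem pmbpGuarantee_of_set (M : MDP S A) {δ err : ℝ}
    {B : Set ((S × A → ℝ) × (SampleIndex S A n → S))} (hB : MeasurableSet B)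
    (hδ : ENNReal.ofReal (1 - δ) ≤ M.pmbpLaw ζ n B)
    (h : ∀ y ∈ B, ∀ π', M.IsPMBPOutput γ y.1 y.2 π' → ∀ π s,
      M.value γ π s - M.value γ π' s ≤ err) :
    PMBPGuarantee.{u, v, w} M γ ζ n δ err := by
  intro Ω _ μ _ Z X πhat hlaw hout
  obtain ⟨E, hEB, hE, hEae⟩ :=
    (hlaw.aemeasurable.nullMeasurableSet_preimage hB).exists_measurable_subset_ae_eq
  refine ⟨E, hE, ?_, fun ω hω s => ⟨?_, ?_⟩⟩
  · rw [measure_congr hEae, ← Measure.map_apply_of_aemeasurable hlaw.aemeasurable hB, hlaw.map_eq]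
    exact hδ
  · exact sub_nonneg.2 (le_ciSup (f := fun π => M.value γ π s) (Set.finite_range _).bddAbove _)
  · have : Nonempty (S → A) := ⟨πhat ω⟩
    rw [sub_le_iff_le_add]
    exact ciSup_le fun π => sub_le_iff_le_add.1 (h _ (hEB hω) _ (hout ω) π s)

theorem PMBPGuarantee.mono {M : MDP S A} {δ err err' : ℝ} (h : PMBPGuarantee.{u, v, w} M γ ζ n δ err)
    (herr : err ≤ err') : PMBPGuarantee.{u, v, w} M γ ζ n δ err' := by
  intro Ω _ μ _ Z X πhat hlaw hout
  obtain ⟨E, hE, hδ, hb⟩ := h Ω μ Z X πhat hlaw hout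
  exact ⟨E, hE, hδ, fun ω hω s => ⟨(hb ω hω s).1, (hb ω hω s).2.trans herr⟩⟩

end Law

variable {S : Type u} {A : Type v} [Fintype S] [DecidableEq S]

theorem kernelMinorizationTime_nonneg (P : Matrix S S ℝ) : 0 ≤ kernelMinorizationTime P := by
  refine Real.sInf_nonneg ?_
  rintro _ ⟨m, q, ⟨-, hq, -⟩, rfl⟩
  positivity

theorem minorizationTime_nonneg (M : MDP S A) : 0 ≤ M.minorizationTime :=
  Real.iSup_nonneg fun _ => kernelMinorizationTime_nonneg _

variable [Fintype A] {n : ℕ} {γ ζ : ℝ}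

/-- The perturbations are in range and the samples at every `(s, a)` concentrate for the values with
`s` absorbing, over a net of `K` absorbed values of mesh `τ`. -/
noncomputable def goodSet (M : MDP S A) (γ ζ l : ℝ) (n : ℕ) (τ : ℝ) (K : ℕ) :
    Set ((S × A → ℝ) × (SampleIndex S A n → S)) :=
  (Set.univ.pi fun _ => Set.Icc 0 ζ) ×ˢ Set.univ ∩
    ⋂ i : (S × A) × Fin K, (M.deviationSet γ l n i.1.1 i.1.2 (i.2 * τ))ᶜ

theorem kernelMinorizationTime_le (M : MDP S A) (π : S → A) :
    kernelMinorizationTime (M.transMatrix π) ≤ M.minorizationTime :=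
  le_ciSup (f := fun π => kernelMinorizationTime (M.transMatrix π))
    (Set.finite_range _).bddAbove π

section Measure

variable [Nonempty A] [MeasurableSpace S] [DiscreteMeasurableSpace S]

theorem measurableSet_goodSet (M : MDP S A) (hn : 1 ≤ n) (h0 : 0 ≤ γ) (h1 : γ < 1) (l τ : ℝ)
    (K : ℕ) : MeasurableSet (M.goodSet γ ζ l n τ K) :=
  ((MeasurableSet.univ_pi fun _ => measurableSet_Icc).prod .univ).inter
    (.iInter fun i => (M.measurableSet_deviationSet hn h0 h1 l i.1.1 i.1.2 _).compl)

theorem one_sub_le_pmbpLaw_goodSet (M : MDP S A) (hn : 1 ≤ n) (h0 : 0 ≤ γ) (h1 : γ < 1)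
    (hζ : 0 < ζ) {L : ℝ} (hL : 0 ≤ L) (τ : ℝ) {K : ℕ} {δ : ℝ}
    (hδ : Fintype.card S * Fintype.card A * K * (2 * Real.exp (-L)) ≤ δ) :
    ENNReal.ofReal (1 - δ) ≤ M.pmbpLaw ζ n (M.goodSet γ ζ (L / n) n τ K) := by
  have := M.isProbabilityMeasure_pmbpLaw (n := n) hζ
  have hδ0 : 0 ≤ δ := le_trans (by positivity) hδ
  set μ := M.pmbpLaw ζ n
  have hbox : μ ((Set.univ.pi fun _ => Set.Icc 0 ζ) ×ˢ Set.univ)ᶜ = 0 := by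
    rw [prob_compl_eq_zero_iff
      ((MeasurableSet.univ_pi fun _ => measurableSet_Icc).prod .univ)]
    exact M.pmbpLaw_box hζ
  have hcompl : μ (M.goodSet γ ζ (L / n) n τ K)ᶜ ≤ ENNReal.ofReal δ := by
    rw [goodSet, Set.compl_inter, Set.compl_iInter]
    refine (measure_union_le _ _).trans ?_
    rw [hbox, zero_add]
    refine (measure_iUnion_fintype_le _ _).trans ?_
    refine (Finset.sum_le_sum fun i _ => ?_).trans_eq
      (Finset.sum_const (ENNReal.ofReal (2 * Real.exp (-L)))) |>.trans ?_
    · rw [compl_compl]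
      exact M.pmbpLaw_deviationSet_le hn h0 h1 hζ hL i.1.1 i.1.2 _
    · rw [nsmul_eq_mul, ← ENNReal.ofReal_natCast, ← ENNReal.ofReal_mul (by positivity)]
      refine ENNReal.ofReal_le_ofReal (le_trans (le_of_eq ?_) hδ)
      simp [Finset.card_univ]
  rw [ENNReal.ofReal_sub _ hδ0, ENNReal.ofReal_one, tsub_le_iff_right, ← measure_univ (μ := μ),
    ← Set.union_compl_self (M.goodSet γ ζ (L / n) n τ K)]
  exact (measure_union_le _ _).trans (add_le_add le_rfl hcompl)

end Measure

/-- On the good set, every output of the planner is nearly optimal for the perturbed rewards. -/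
theorem policyValue_sub_le_of_mem_goodSet [Nonempty A] (M : MDP S A) (herg : M.UniformlyErgodic)
    (hn : 1 ≤ n) (h0 : 1 / 2 ≤ γ) (h1 : γ < 1) (ht : M.minorizationTime ≤ (1 - γ)⁻¹)
    (hζ : ζ ≤ 1 / 2) {l τ : ℝ} {K : ℕ} (hl0 : 0 ≤ l) (hl : 128 * l * (1 - γ)⁻¹ ≤ 1)
    (hτ : 0 < τ) (hK : (1 - γ)⁻¹ * (3 / 2) / τ < K)
    {y : (S × A → ℝ) × (SampleIndex S A n → S)} (hy : y ∈ M.goodSet γ ζ l n τ K)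
    {π' : S → A} (hπ' : M.IsPMBPOutput γ y.1 y.2 π') (π : S → A) (s : S) :
    policyValue γ M.r M.prob π s - policyValue γ M.r M.prob π' s ≤
      40 * ((1 - γ)⁻¹ * √(l * M.minorizationTime)) + (1 - γ)⁻¹ * (18 * τ + ζ) := by
  have hγ : 0 ≤ γ := by linarith
  have hH : 0 < 1 - γ := by linarith
  have hH2 : 2 ≤ (1 - γ)⁻¹ := by
    rw [le_inv_comm₀ two_pos hH]; linarith
  obtain ⟨⟨hz, -⟩, hdev⟩ := hy
  have hz0 : ∀ s a, 0 ≤ y.1 (s, a) := fun s a => (hz (s, a) trivial).1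
  have hz1 : ∀ s a, y.1 (s, a) ≤ ζ := fun s a => (hz (s, a) trivial).2
  set R : S → A → ℝ := fun s a => M.r s a + y.1 (s, a) with hR
  have hR0 : ∀ s a, 0 ≤ R s a := fun s a => add_nonneg (M.r_nonneg s a) (hz0 s a)
  have hR1 : ∀ s a, R s a ≤ 3 / 2 := fun s a => by
    have := M.r_le_one s a
    have := hz1 s a
    simp only [hR]; linarith
  have hq := empiricalKernel_mem (A := A) hn y.2
  obtain ⟨u, hu, hgreedy⟩ := hπ'
  have hu' : IsBellmanSolution γ R (empiricalKernel y.2) u := hu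
  have hT : ∀ π a b, policyValue γ R M.prob π a - policyValue γ R M.prob π b ≤
      3 / 2 * M.minorizationTime := fun π a b => by
    refine (sub_le_kernelMinorizationTime (policyMatrix_mem M.prob_mem π) hγ h1
      (ρ := 3 / 2) (by norm_num) (policyValue_eq M.prob_mem hγ h1 R π) (fun s => hR0 s _)
      (fun s => hR1 s _) (herg π) a b).trans ?_
    exact mul_le_mul_of_nonneg_left (M.kernelMinorizationTime_le π) (by norm_num)
  have he : ∀ s a, |empiricalKernel y.2 s a ⬝ᵥ u - M.prob s a ⬝ᵥ u| ≤
      2 * √l * wsd (M.prob s a) u + l * osc u + 3 * τ := fun s a => by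
    obtain ⟨hu0, hu1⟩ := hu'.bounds hq hγ h1 hR0 hR1 s
    -- The net point is `u s` rounded down to a multiple of `τ`; `K` points suffice since `0 ≤ u ≤
    -- (3/2) (1 - γ)⁻¹`.
    have hk : ⌊u s / τ⌋₊ < K := by
      rw [Nat.floor_lt (by positivity)]
      exact (div_le_div_of_nonneg_right hu1 hτ.le).trans_lt hK
    have hclose : |u s - (⌊u s / τ⌋₊ : ℝ) * τ| ≤ τ := by
      have h2 := Nat.floor_le (div_nonneg hu0 hτ.le)
      have h3 := Nat.lt_floor_add_one (u s / τ)
      rw [le_div_iff₀ hτ] at h2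
      rw [div_lt_iff₀ hτ] at h3
      exact abs_le.2 ⟨by linarith, by linarith⟩
    have h2 := Set.mem_iInter.1 hdev ((s, a), ⟨_, hk⟩)
    refine abs_dotProduct_sub_le_of_close (M.prob_mem s a) (hq s a) hτ.le hl0 (by nlinarith)
      (abs_absorbed_sub_le hq hγ h1 hu' hτ.le hclose) (not_lt.1 h2)
  -- Used with `c = 3 τ`, whence `6 * 3 τ = 18 τ`. Returning to the unperturbed rewards costs a
  -- further `(1 - γ)⁻¹ ζ`, on one side only because the perturbation is nonnegative.
  have key := policyValue_sub_le_of_greedy M.prob_mem h0 h1 hR0 hR1 M.minorizationTime_nonneg ht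
    (by positivity) hT hl0 hl hu' hgreedy he π s
  have hlow : policyValue γ M.r M.prob π s ≤ policyValue γ R M.prob π s :=
    resolvent_mono (policyMatrix_mem M.prob_mem π) hγ h1
      (fun s => by simpa [hR] using hz0 s (π s)) s
  have hup : policyValue γ R M.prob π' s ≤ policyValue γ M.r M.prob π' s + (1 - γ)⁻¹ * ζ := by
    have h2 := resolvent_mono (policyMatrix_mem M.prob_mem π') hγ h1
      (f := fun s => R s (π' s)) (g := (fun s => M.r s (π' s)) + fun _ => ζ)
      (fun s => by simpa [hR] using hz1 s (π' s)) s
    rw [resolvent_add, resolvent_const (policyMatrix_mem M.prob_mem π') hγ h1] at h2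
    exact h2
  linarith

section Guarantee

variable [MeasurableSpace S] [DiscreteMeasurableSpace S]
  [MeasurableSpace A] [DiscreteMeasurableSpace A]

/-- Values differ by at most the effective horizon. -/
theorem value_sub_le (M : MDP S A) (h0 : 0 ≤ γ) (h1 : γ < 1) (π π' : S → A) (s : S) :
    M.value γ π s - M.value γ π' s ≤ (1 - γ)⁻¹ := by
  rw [value_eq_policyValue M h0 h1, value_eq_policyValue M h0 h1]
  have h2 := discResolvent_le_mul (policyMatrix_mem M.prob_mem π) h0 h1
    (f := fun s => M.r s (π s)) (c := 1) (fun s => M.r_le_one _ _) s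
  have h3 := resolvent_nonneg (policyMatrix_mem M.prob_mem π') h0 h1
    (f := fun s => M.r s (π' s)) (fun s => M.r_nonneg _ _) s
  simp only [Pi.zero_apply, mul_one] at h2 h3
  unfold policyValue
  linarith

end Guarantee

end MDP

/-! ### Estimates of the logarithmic factor. -/

section Numerics

/-- The argument of the logarithm in `betaStar`, simplified. -/
noncomputable def betaArg (S : Type u) (A : Type v) [Fintype S] [Fintype A] (γ ζ δ : ℝ) : ℝ :=
  216 * (Fintype.card S : ℝ) ^ 2 * (Fintype.card A : ℝ) ^ 3 * Real.logb 2 (1 - γ)⁻¹ *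
    (1 - γ)⁻¹ ^ 3 / (ζ * δ ^ 2)

variable {S : Type u} {A : Type v} [Fintype S] [Fintype A] {γ ζ δ : ℝ}

theorem two_le_horizon (h0 : 1 / 2 ≤ γ) (h1 : γ < 1) : 2 ≤ (1 - γ)⁻¹ := by
  rw [le_inv_comm₀ two_pos (by linarith)]; linarith

theorem one_le_card [Nonempty S] : (1 : ℝ) ≤ Fintype.card S := by
  exact_mod_cast Fintype.card_pos

theorem betaStar_eq [Nonempty S] [Nonempty A] (h1 : γ < 1) (hζ : 0 < ζ) (hδ : 0 < δ) :
    betaStar S A γ ζ δ = 2 * Real.log (betaArg S A γ ζ δ) := by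
  have hs := one_le_card (S := S)
  have ha := one_le_card (S := A)
  have hH : 0 < 1 - γ := by linarith
  unfold betaStar betaParam etaStar betaArg
  congr 2
  field_simp
  ring

/-- What the union bound needs: `exp (-L) = 1 / betaArg` must beat the number of state-action pairs
times the size of the net. -/
theorem le_betaArg [Nonempty S] [Nonempty A] (h0 : 1 / 2 ≤ γ) (h1 : γ < 1) (hζ : 0 < ζ)
    (hδ : 0 < δ) (hδ1 : δ < 1) :
    864 * (Fintype.card S * Fintype.card A * (1 - γ)⁻¹ / (ζ * δ)) ≤ betaArg S A γ ζ δ := by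
  have hs := one_le_card (S := S)
  have ha := one_le_card (S := A)
  have hH := two_le_horizon h0 h1
  have hlog : 1 ≤ Real.logb 2 (1 - γ)⁻¹ := by
    rw [Real.le_logb_iff_rpow_le one_lt_two (by linarith), Real.rpow_one]; exact hH
  unfold betaArg
  set H := (1 - γ)⁻¹
  set s : ℝ := (Fintype.card S : ℝ)
  set a : ℝ := (Fintype.card A : ℝ)
  rw [← mul_div_assoc, div_le_div_iff₀ (by positivity) (by positivity)]
  have e1 : s ≤ s ^ 2 := by nlinarith
  have e2 : a ≤ a ^ 3 := le_self_pow₀ ha (by norm_num)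
  have e3 : 4 * H ≤ H ^ 3 := by
    have : 4 ≤ H ^ 2 := by nlinarith
    nlinarith
  have e4 : δ ^ 2 ≤ δ := by nlinarith
  calc 864 * (s * a * H) * (ζ * δ ^ 2) = 216 * s * a * 1 * (4 * H) * (ζ * δ ^ 2) := by ring
    _ ≤ 216 * s ^ 2 * a ^ 3 * Real.logb 2 H * H ^ 3 * (ζ * δ) := by gcongr

/-- Polynomial domination, so that the logarithm is at most a multiple of Λ. With `Y` the argument
of Λ, the main factor is at most `Y ^ 5`, and the constant `1728 ≤ 2 ^ 11` is absorbed through `2 ≤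
Y`. -/
theorem betaArg_le [Nonempty S] [Nonempty A] (h0 : 1 / 2 ≤ γ) (h1 : γ < 1) {ε : ℝ} (hε : 0 < ε)
    (hδ : 0 < δ) (hδ1 : δ < 1) (hζ : ζ = (1 - γ) * ε / 4) :
    betaArg S A γ ζ δ ≤ (Fintype.card S * Fintype.card A / ((1 - γ) * δ * min ε 1)) ^ 16 ∧
      2 ≤ Fintype.card S * Fintype.card A / ((1 - γ) * δ * min ε 1) := by
  have hs := one_le_card (S := S)
  have ha := one_le_card (S := A)
  have hH := two_le_horizon h0 h1
  have h1' : 0 < 1 - γ := by linarith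
  have hlog : Real.logb 2 (1 - γ)⁻¹ ≤ 2 * (1 - γ)⁻¹ := by
    rw [Real.logb, div_le_iff₀ (Real.log_pos one_lt_two)]
    have := Real.log_le_sub_one_of_pos (by positivity : 0 < (1 - γ)⁻¹)
    nlinarith [Real.log_two_gt_d9]
  have eζ : betaArg S A γ ζ δ = 864 * (Fintype.card S : ℝ) ^ 2 * (Fintype.card A : ℝ) ^ 3 *
      Real.logb 2 (1 - γ)⁻¹ * (1 - γ)⁻¹ ^ 4 / (ε * δ ^ 2) := by
    rw [betaArg, hζ]
    field_simp
    ring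
  have eY : (Fintype.card S * Fintype.card A / ((1 - γ) * δ * min ε 1) : ℝ) =
      Fintype.card S * Fintype.card A * (1 - γ)⁻¹ / (δ * min ε 1) := by
    have : 0 < min ε 1 := lt_min hε one_pos
    field_simp
  rw [eζ, eY]
  set H := (1 - γ)⁻¹
  set s : ℝ := (Fintype.card S : ℝ)
  set a : ℝ := (Fintype.card A : ℝ)
  have hm : 0 < min ε 1 := lt_min hε one_pos
  have hm1 : min ε 1 ≤ 1 := min_le_right _ _
  set m := min ε 1
  have hsa : 1 ≤ s * a := one_le_mul_of_one_le_of_one_le hs ha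
  have hY2 : 2 ≤ s * a * H / (δ * m) := by
    rw [le_div_iff₀ (by positivity)]
    have : δ * m ≤ 1 := mul_le_one₀ hδ1.le hm.le hm1
    nlinarith
  refine ⟨?_, hY2⟩
  set Y := s * a * H / (δ * m) with hY
  have k1 : s ^ 2 * a ^ 3 * H ^ 5 / (ε * δ ^ 2) ≤ Y ^ 5 := by
    rw [hY, div_pow, mul_pow, mul_pow, mul_pow]
    have e1 : s ^ 2 ≤ s ^ 5 := pow_le_pow_right₀ hs (by norm_num)
    have e2 : a ^ 3 ≤ a ^ 5 := pow_le_pow_right₀ ha (by norm_num)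
    have e3 : δ ^ 5 ≤ δ ^ 2 := pow_le_pow_of_le_one hδ.le hδ1.le (by norm_num)
    have e4 : m ^ 5 ≤ ε := (pow_le_of_le_one hm.le hm1 (by norm_num)).trans (min_le_left _ _)
    rw [mul_comm ε]
    gcongr
  have hH0 : 0 < H := by linarith
  calc 864 * s ^ 2 * a ^ 3 * Real.logb 2 H * H ^ 4 / (ε * δ ^ 2)
      ≤ 864 * s ^ 2 * a ^ 3 * (2 * H) * H ^ 4 / (ε * δ ^ 2) := by gcongr
    _ = 1728 * (s ^ 2 * a ^ 3 * H ^ 5 / (ε * δ ^ 2)) := by ring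
    _ ≤ 2 ^ 11 * Y ^ 5 := by
        have : 0 ≤ Y ^ 5 := by positivity
        nlinarith
    _ ≤ Y ^ 11 * Y ^ 5 := by gcongr
    _ = Y ^ 16 := by ring

theorem betaStar_le [Nonempty S] [Nonempty A] (h0 : 1 / 2 ≤ γ) (h1 : γ < 1) {ε : ℝ} (hε : 0 < ε)
    (hδ : 0 < δ) (hδ1 : δ < 1) (hζ : ζ = (1 - γ) * ε / 4) :
    betaStar S A γ ζ δ ≤
      32 * Real.log (Fintype.card S * Fintype.card A / ((1 - γ) * δ * min ε 1)) := by
  have h1' : 0 < 1 - γ := by linarith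
  have hζ0 : 0 < ζ := by rw [hζ]; positivity
  have hs := one_le_card (S := S)
  have ha := one_le_card (S := A)
  have hpos : 0 < betaArg S A γ ζ δ :=
    lt_of_lt_of_le (by positivity) (le_betaArg h0 h1 hζ0 hδ hδ1)
  have h2 := Real.log_le_log hpos (betaArg_le (S := S) (A := A) h0 h1 hε hδ hδ1 hζ).1
  rw [Real.log_pow] at h2
  rw [betaStar_eq h1 hζ0 hδ]
  push_cast at h2
  linarith

theorem one_le_log_betaArg [Nonempty S] [Nonempty A] (h0 : 1 / 2 ≤ γ) (h1 : γ < 1) (hζ : 0 < ζ)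
    (hζ1 : ζ ≤ 1 / 2) (hδ : 0 < δ) (hδ1 : δ < 1) : 1 ≤ Real.log (betaArg S A γ ζ δ) := by
  have hs := one_le_card (S := S)
  have ha := one_le_card (S := A)
  have hH := two_le_horizon h0 h1
  have h2 : 1 ≤ Fintype.card S * Fintype.card A * (1 - γ)⁻¹ / (ζ * δ) := by
    rw [le_div_iff₀ (by positivity)]
    have hsa : (1 : ℝ) ≤ Fintype.card S * Fintype.card A :=
      one_le_mul_of_one_le_of_one_le hs ha
    nlinarith
  have h3 : Real.exp 1 ≤ betaArg S A γ ζ δ := by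
    have := le_betaArg (S := S) (A := A) h0 h1 hζ hδ hδ1
    linarith [Real.exp_one_lt_d9]
  exact (Real.le_log_iff_exp_le ((Real.exp_pos 1).trans_le h3)).2 h3

end Numerics

/-! ### The error bound and the sample complexity. -/

namespace MDP

variable {S : Type u} {A : Type v} [Fintype S] [DecidableEq S] [Nonempty S] [MeasurableSpace S]
  [DiscreteMeasurableSpace S] [Fintype A] [Nonempty A] [MeasurableSpace A]
  [DiscreteMeasurableSpace A] {γ ζ δ : ℝ} {n : ℕ}

theorem pmbpGuarantee_error (M : MDP S A) (herg : M.UniformlyErgodic) (h0 : 1 / 2 ≤ γ) (h1 : γ < 1)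
    (hδ : 0 < δ) (hδ1 : δ < 1) (ht : M.minorizationTime ≤ (1 - γ)⁻¹) (hζ : 0 < ζ) (hn : 1 ≤ n)
    (hn' : 64 * betaStar S A γ ζ δ * (1 - γ)⁻¹ ≤ n) :
    PMBPGuarantee.{u, v, w} M γ ζ n δ
      (2 * ζ / (1 - γ) +
        486 * √(betaStar S A γ ζ δ * M.minorizationTime / ((1 - γ) ^ 2 * n))) := by
  have hγ : 0 ≤ γ := by linarith
  have h1' : 0 < 1 - γ := by linarith
  have hH : 0 < (1 - γ)⁻¹ := inv_pos.2 h1'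
  have hn0 : (0 : ℝ) < n := by exact_mod_cast hn
  have hvalue := fun π s => M.value_eq_policyValue hγ h1 π s
  rcases le_or_gt ζ (1 / 2) with hζ1 | hζ1
  · have hL := one_le_log_betaArg (S := S) (A := A) h0 h1 hζ hζ1 hδ hδ1
    have hX := le_betaArg (S := S) (A := A) h0 h1 hζ hδ hδ1
    have hs := one_le_card (S := S)
    have ha := one_le_card (S := A)
    have hH2 := two_le_horizon h0 h1
    have hXpos : 0 < betaArg S A γ ζ δ := lt_of_lt_of_le (by positivity) hX
    rw [betaStar_eq h1 hζ hδ] at hn' ⊢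
    set L := Real.log (betaArg S A γ ζ δ) with hLdef
    set t := M.minorizationTime with htdef
    have ht0 : 0 ≤ t := M.minorizationTime_nonneg
    -- Mesh `ζ / 100`: at most `151 (1 - γ)⁻¹ / ζ` points, so the two-sided union bound has constant
    -- `302 ≤ 864`, and the net costs only `18 ζ / 100`.
    set K : ℕ := ⌊(1 - γ)⁻¹ * (3 / 2) / (ζ / 100)⌋₊ + 1 with hKdef
    have hK : (1 - γ)⁻¹ * (3 / 2) / (ζ / 100) < K := by
      rw [hKdef]; push_cast; exact Nat.lt_floor_add_one _
    have hK2 : (K : ℝ) ≤ 151 * ((1 - γ)⁻¹ / ζ) := by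
      have h2 : (K : ℝ) ≤ (1 - γ)⁻¹ * (3 / 2) / (ζ / 100) + 1 := by
        rw [hKdef]; push_cast
        exact add_le_add (Nat.floor_le (by positivity)) le_rfl
      have h3 : 1 ≤ (1 - γ)⁻¹ / ζ := by rw [le_div_iff₀ hζ]; linarith
      have h4 : (1 - γ)⁻¹ * (3 / 2) / (ζ / 100) = 150 * ((1 - γ)⁻¹ / ζ) := by ring
      linarith
    have hexp : Real.exp (-L) = (betaArg S A γ ζ δ)⁻¹ := by
      rw [Real.exp_neg, hLdef, Real.exp_log hXpos]
    have hprob : Fintype.card S * Fintype.card A * K * (2 * Real.exp (-L)) ≤ δ := by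
      rw [hexp, ← mul_assoc, ← div_eq_mul_inv, div_le_iff₀ hXpos]
      calc (Fintype.card S * Fintype.card A * K * 2 : ℝ)
          ≤ Fintype.card S * Fintype.card A * (151 * ((1 - γ)⁻¹ / ζ)) * 2 := by gcongr
        _ = 302 * (δ * (Fintype.card S * Fintype.card A * (1 - γ)⁻¹ / (ζ * δ))) := by
            field_simp; ring
        _ ≤ 864 * (δ * (Fintype.card S * Fintype.card A * (1 - γ)⁻¹ / (ζ * δ))) := by
            gcongr; norm_num
        _ = δ * (864 * (Fintype.card S * Fintype.card A * (1 - γ)⁻¹ / (ζ * δ))) := by ring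
        _ ≤ δ * betaArg S A γ ζ δ := by gcongr
    have hl0 : 0 ≤ L / n := by positivity
    -- Since `betaStar` equals `2 L`, this is exactly the lower bound assumed on `n`.
    have hl : 128 * (L / n) * (1 - γ)⁻¹ ≤ 1 := by
      rw [show 128 * (L / n) * (1 - γ)⁻¹ = 64 * (2 * L) * (1 - γ)⁻¹ / n by ring, div_le_one hn0]
      exact hn'
    refine pmbpGuarantee_of_set M (M.measurableSet_goodSet hn hγ h1 (L / n) (ζ / 100) K)
      (M.one_sub_le_pmbpLaw_goodSet hn hγ h1 hζ (by linarith) (ζ / 100) hprob)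
      fun y hy π' hπ' π s => ?_
    rw [hvalue, hvalue]
    refine (M.policyValue_sub_le_of_mem_goodSet herg hn h0 h1 ht hζ1 hl0 hl (by positivity) hK hy
      hπ' π s).trans ?_
    have e1 : √(2 * L * t / ((1 - γ) ^ 2 * n)) = (1 - γ)⁻¹ * √(2 * (L / n * t)) := by
      rw [show 2 * L * t / ((1 - γ) ^ 2 * n) = (1 - γ)⁻¹ ^ 2 * (2 * (L / n * t)) by field_simp,
        Real.sqrt_mul (by positivity), Real.sqrt_sq hH.le]
    have e2 : √(L / n * t) ≤ √(2 * (L / n * t)) :=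
      Real.sqrt_le_sqrt (by nlinarith [mul_nonneg hl0 ht0])
    have e3 := mul_le_mul_of_nonneg_left e2 hH.le
    have e4 : 0 ≤ (1 - γ)⁻¹ * √(2 * (L / n * t)) := by positivity
    have e5 : 2 * ζ / (1 - γ) = 2 * ((1 - γ)⁻¹ * ζ) := by ring
    have e6 : 0 ≤ (1 - γ)⁻¹ * ζ := by positivity
    rw [e1, e5]
    have e7 : (1 - γ)⁻¹ * (18 * (ζ / 100) + ζ) = 118 / 100 * ((1 - γ)⁻¹ * ζ) := by ring
    rw [e7]
    linarith
  -- For `ζ > 1/2` the error term exceeds `(1 - γ)⁻¹`, which bounds every difference of values, so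
  -- the whole space serves as the event.
  · have := M.isProbabilityMeasure_pmbpLaw (n := n) hζ
    refine pmbpGuarantee_of_set M .univ ?_ fun y _ π' _ π s =>
      (M.value_sub_le hγ h1 π π' s).trans ?_
    · rw [measure_univ, ← ENNReal.ofReal_one]
      exact ENNReal.ofReal_le_ofReal (by linarith)
    · have e1 : 2 * ζ / (1 - γ) = (2 * ζ) * (1 - γ)⁻¹ := div_eq_mul_inv _ _
      rw [e1]
      have := Real.sqrt_nonneg (betaStar S A γ ζ δ * M.minorizationTime / ((1 - γ) ^ 2 * n))
      nlinarith

end MDP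

theorem numSamples_eq (S : Type u) (A : Type v) [Fintype S] [Fintype A] (n : ℕ) :
    (numSamples S A n : ℝ) = Fintype.card S * Fintype.card A * n := by
  simp [numSamples, SampleIndex]

theorem numSamples_ceil_le (S : Type u) (A : Type v) [Fintype S] [Fintype A] {x : ℝ} (hx : 1 ≤ x) :
    (numSamples S A ⌈x⌉₊ : ℝ) ≤ Fintype.card S * Fintype.card A * (2 * x) := by
  rw [numSamples_eq]
  have := Nat.ceil_lt_add_one (zero_le_one.trans hx)
  gcongr
  linarith

theorem mainTheorem2 :
    ∃ C : ℝ, 0 < C ∧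
      ∀ (S : Type u) (A : Type v)
        [Fintype S] [DecidableEq S] [Nonempty S] [MeasurableSpace S] [DiscreteMeasurableSpace S]
        [Fintype A] [Nonempty A] [MeasurableSpace A] [DiscreteMeasurableSpace A]
        (M : MDP S A) (γ δ : ℝ),
        M.UniformlyErgodic → 1 / 2 ≤ γ → γ < 1 → 0 < δ → δ < 1 →
        M.minorizationTime ≤ (1 - γ)⁻¹ →
        -- the error bound
        (∀ (ζ : ℝ) (n : ℕ), 0 < ζ → 1 ≤ n → 64 * betaStar S A γ ζ δ * (1 - γ)⁻¹ ≤ n →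
          MDP.PMBPGuarantee.{u, v, w} M γ ζ n δ
            (2 * ζ / (1 - γ) +
              486 * Real.sqrt (betaStar S A γ ζ δ * M.minorizationTime / ((1 - γ) ^ 2 * n)))) ∧
        -- the sample complexity
        (∀ ε ζ : ℝ, 0 < ε → ε ≤ Real.sqrt (M.minorizationTime / (1 - γ)) →
          ζ = (1 - γ) * ε / 4 →
          (∀ n : ℕ,
            4 * 486 ^ 2 * M.minorizationTime * betaStar S A γ ζ δ / ((1 - γ) ^ 2 * ε ^ 2) ≤ n →
            MDP.PMBPGuarantee.{u, v, w} M γ ζ n δ ε) ∧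
          (numSamples S A
              ⌈4 * 486 ^ 2 * M.minorizationTime * betaStar S A γ ζ δ /
                ((1 - γ) ^ 2 * ε ^ 2)⌉₊ : ℝ) ≤
            C * (Fintype.card S * Fintype.card A * M.minorizationTime / ((1 - γ) ^ 2 * ε ^ 2)) *
              Real.log (Fintype.card S * Fintype.card A / ((1 - γ) * δ * min ε 1)) ∧
          (numSamples S A ⌈64 * betaStar S A γ ζ δ * (1 - γ)⁻¹⌉₊ : ℝ) ≤
            C * (Fintype.card S * Fintype.card A / (1 - γ)) *
              Real.log (Fintype.card S * Fintype.card A / ((1 - γ) * δ * min ε 1))) := by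
  -- `4 * 486²` from the sample size, times 2 for the ceiling and 32 from `betaStar_le`.
  refine ⟨256 * 486 ^ 2, by norm_num, ?_⟩
  intro S A _ _ _ _ _ _ _ _ _ M γ δ herg h0 h1 hδ hδ1 ht
  refine ⟨fun ζ n hζ hn hn' => M.pmbpGuarantee_error herg h0 h1 hδ hδ1 ht hζ hn hn',
    fun ε ζ hε hεt hζ => ?_⟩
  have h1' : 0 < 1 - γ := by linarith
  have hH := two_le_horizon h0 h1
  have hs := one_le_card (S := S)
  have ha := one_le_card (S := A)
  have ht0 := M.minorizationTime_nonneg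
  set t := M.minorizationTime
  have hε2 : ε ^ 2 ≤ t * (1 - γ)⁻¹ := by
    rw [← div_eq_mul_inv]
    exact (Real.le_sqrt hε.le (by positivity)).1 hεt
  have hεH : ε ≤ (1 - γ)⁻¹ := by
    refine le_of_sq_le_sq ?_ (by linarith)
    nlinarith
  have hζ0 : 0 < ζ := by rw [hζ]; positivity
  have hζ1 : ζ ≤ 1 / 2 := by
    have : (1 - γ) * ε ≤ 1 := by
      have := mul_le_mul_of_nonneg_left hεH h1'.le
      rwa [mul_inv_cancel₀ h1'.ne'] at this
    rw [hζ]; linarith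
  have hβ1 : 1 ≤ betaStar S A γ ζ δ := by
    rw [betaStar_eq h1 hζ0 hδ]
    linarith [one_le_log_betaArg (S := S) (A := A) h0 h1 hζ0 hζ1 hδ hδ1]
  have hβ2 := betaStar_le (S := S) (A := A) h0 h1 hε hδ hδ1 hζ
  set β := betaStar S A γ ζ δ
  set Λ := Real.log (Fintype.card S * Fintype.card A / ((1 - γ) * δ * min ε 1))
  -- The restriction on `ε` enters here: it makes the sample size for accuracy `ε` dominate the
  -- minimum required by the error bound.
  have hD : (1 - γ)⁻¹ ≤ t / ((1 - γ) ^ 2 * ε ^ 2) := by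
    rw [le_div_iff₀ (by positivity)]
    have : (1 - γ)⁻¹ * ((1 - γ) ^ 2 * ε ^ 2) = (1 - γ) * ε ^ 2 := by field_simp
    rw [this]
    have := mul_le_mul_of_nonneg_left hε2 h1'.le
    rwa [mul_comm t, mul_inv_cancel_left₀ h1'.ne'] at this
  have hnε : 4 * 486 ^ 2 * t * β / ((1 - γ) ^ 2 * ε ^ 2) =
      4 * 486 ^ 2 * (t / ((1 - γ) ^ 2 * ε ^ 2) * β) := by ring
  have hDβ : (1 - γ)⁻¹ * β ≤ t / ((1 - γ) ^ 2 * ε ^ 2) * β :=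
    mul_le_mul_of_nonneg_right hD (by linarith)
  have hHβ : 2 ≤ (1 - γ)⁻¹ * β := by nlinarith
  refine ⟨fun n hn => ?_, ?_, ?_⟩
  · have hn1 : (1 : ℝ) ≤ n := by rw [hnε] at hn; linarith
    have hn0 : (0 : ℝ) < n := by linarith
    refine (M.pmbpGuarantee_error herg h0 h1 hδ hδ1 ht hζ0 (by exact_mod_cast hn1) ?_).mono ?_
    · rw [hnε] at hn
      change 64 * β * (1 - γ)⁻¹ ≤ n
      linarith
    -- The perturbation term and the statistical term each take half of `ε`.
    · have e1 : 2 * ζ / (1 - γ) = ε / 2 := by rw [hζ]; field_simp; ring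
      have e2 : √(β * t / ((1 - γ) ^ 2 * n)) ≤ ε / (2 * 486) := by
        refine Real.sqrt_le_iff.2 ⟨by positivity, ?_⟩
        rw [div_le_iff₀ (by positivity)] at hn ⊢
        have : (ε / (2 * 486)) ^ 2 * ((1 - γ) ^ 2 * n) =
          n * ((1 - γ) ^ 2 * ε ^ 2) / (4 * 486 ^ 2) := by ring
        rw [this, le_div_iff₀ (by norm_num)]
        linarith
      change 2 * ζ / (1 - γ) + 486 * √(β * t / ((1 - γ) ^ 2 * n)) ≤ ε
      rw [e1]
      linarith
  · rw [hnε]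
    refine (numSamples_ceil_le S A (by linarith)).trans ?_
    have e1 : t / ((1 - γ) ^ 2 * ε ^ 2) * β ≤ t / ((1 - γ) ^ 2 * ε ^ 2) * (32 * Λ) :=
      mul_le_mul_of_nonneg_left hβ2 (by positivity)
    calc (Fintype.card S * Fintype.card A : ℝ) *
          (2 * (4 * 486 ^ 2 * (t / ((1 - γ) ^ 2 * ε ^ 2) * β)))
        ≤ Fintype.card S * Fintype.card A *
          (2 * (4 * 486 ^ 2 * (t / ((1 - γ) ^ 2 * ε ^ 2) * (32 * Λ)))) := by gcongr
      _ = _ := by ring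
  · refine (numSamples_ceil_le S A (by linarith)).trans ?_
    have hΛ : 0 ≤ Λ := by linarith
    have e1 : (1 - γ)⁻¹ * β ≤ (1 - γ)⁻¹ * (32 * Λ) :=
      mul_le_mul_of_nonneg_left hβ2 (by linarith)
    calc (Fintype.card S * Fintype.card A : ℝ) * (2 * (64 * β * (1 - γ)⁻¹))
        = 128 * (Fintype.card S * Fintype.card A * ((1 - γ)⁻¹ * β)) := by ring
      _ ≤ 128 * (Fintype.card S * Fintype.card A * ((1 - γ)⁻¹ * (32 * Λ))) := by gcongr
      _ = 4096 * (Fintype.card S * Fintype.card A / (1 - γ) * Λ) := by ring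
      _ ≤ 256 * 486 ^ 2 * (Fintype.card S * Fintype.card A / (1 - γ) * Λ) := by
          gcongr; norm_num
      _ = _ := by ring
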